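/- Conventions. Let $T$ be a real representation of a group $G$. Call a subspace $P\subseteq T$ \emph{special in the first sense} if there is a proper subspace $P'\subsetneq P$ such that $g|_P$ is determined by $g|_{P'}$ for all $g\in G$, and such that whenever $P''\supseteq P$ and $g|_{P''}$ is determined by $g|_{P'}$ for all $g\in G$, then $P''=P$. Call $P$ \emph{special in the second sense} if there is a proper subspace $P'\subsetneq P$ such that $g(P)$ is determined by $g(P')$ for all $g\in G$, and such that whenever $P'\subsetneq P''\subseteq P$ and $g(P'')$ is determined by $g(P')$ for all $g\in G$, then $P''=P$. Let $M$ be a Riemannian $n$-manifold whose structure group is reduced to $G\subseteq SO(n)$ by a subbundle $P_G$ of the orthonormal frame bundle; a frame in $P_G$ at $p$ makes $T_pM$ a representation of $G$. Then $G$ is a \emph{weak holonomy group} of $M$ if for each $p\in M$ and each smooth loop $\gamma:[0,1]\to M$ at $p$ there is $g\in G$ such that the parallel translation $\tau_\gamma$ satisfies $\tau_\gamma|_P=g|_P$ for every special subspace $P$ of $T_pM$ of minimal dimension with $\dot\gamma(0)\in P$. Finally, with $e^{i_1\dots i_k}=e^{i_1}\wedge\dots\wedge e^{i_k}$, put $\varphi_0=e^{123}+e^{145}-e^{167}+e^{246}+e^{257}+e^{347}-e^{356}$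 on $\mathbb R^7$ and $G_2=\{g\in SO(7): g(\varphi_0)=\varphi_0\}$. Theorem. On $\mathbb R^8$ let $$\theta=e^{1234}+e^{1256}-e^{1278}+e^{1357}+e^{1368}+e^{1458}-e^{1467}+e^{5678}-e^{3456}+e^{2457}-e^{2358}+e^{2367}+e^{3478}+e^{2468}.$$ On the unit sphere $S^7\subset\mathbb R^8$ with its standard metric $\langle\cdot,\cdot\rangle$ and Levi-Civita connection $\nabla$ let $\varphi_x(X,Y,Z)=\theta(x,X,Y,Z)$ for $X,Y,Z\in T_xS^7$, and let $\Phi_x(X,Y)\in T_xS^7$ be given by $\langle\Phi_x(X,Y),Z\rangle=\varphi_x(X,Y,Z)$. Then: 1. $\Phi$ is a vector cross product: $\Phi(X,Y)$ is orthogonal to $X$ and $Y$, and $|\Phi(X,Y)|^2=|X|^2|Y|^2-\langle X,Y\rangle^2$. The orthonormal frames of $S^7$ in which $\varphi$ becomes $\varphi_0$ form a reduction of the structure group to $G_2$. 2. $\Phi$ is nearly parallel: $(\nabla_X\varphi)(X,Y,Z)=0$ and $(\nabla_X\Phi)(X,Y)=0$ for all vector fields $X,Y,Z$ on $S^7$.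 3. With this reduction, $G_2$ is not a weak holonomy group of $S^7$, whichever of the two senses of special subspace is used. 4. Let $r\in(0,1)$, $s=\sqrt{1-r^2}$ and $x_t=(r\cos t,r\sin t,0,s,0,0,0,0)$, so that $x_{2\pi}=x_0$. Put $X_0=\dot x_0=(0,r,0,0,0,0,0,0)$, $Y_0=(0,0,r^2,0,0,-rs,0,0)$ and $Z_0=\Phi_{x_0}(X_0,Y_0)$. The parallel translates of $X_0,Y_0,Z_0$ along $x_t$ are $$X_t=\Bigl(-\tfrac{r^3\sin((1+s)t)}{2(1+s)}-\tfrac{r^3\sin((1-s)t)}{2(1-s)},\ \tfrac{r^3\cos((1+s)t)}{2(1+s)}+\tfrac{r^3\cos((1-s)t)}{2(1-s)},\ 0,\ -r^2\sin(st),\ 0,0,0,0\Bigr),$$ $$Y_t=Y_0,$$ $$Z_t=\Bigl(\tfrac{r^5\cos((1+s)t)}{2(1+s)}-\tfrac{r^5\cos((1-s)t)}{2(1-s)},\ \tfrac{r^5\sin((1+s)t)}{2(1+s)}-\tfrac{r^5\sin((1-s)t)}{2(1-s)},\ 0,\ r^4\cos(st),\ r^3s,\ 0,\ 0,\ r^2(1-r^2)\Bigr).$$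 The subspace $\mathrm{span}\{X_0,Y_0,Z_0\}$ of $T_{x_0}S^7$ is a special subspace for $G_2$ of minimal dimension, in both senses, and $Z_{2\pi}\neq\Phi_{x_{2\pi}}(X_{2\pi},Y_{2\pi})$. -/

import Mathlib

open scoped RealInnerProductSpace ContDiff

noncomputable section

/-! ### Special subspaces of a representation -/

section Special

variable {G T : Type*} [Group G] [AddCommGroup T] [Module ℝ T]

/-- `g|_P` is determined by `g|_{P'}` for all `g ∈ G`. -/
def RestrictionDetermines (ρ : Representation ℝ G T) (P' P : Submodule ℝ T) : Prop :=
  ∀ g h : G, (∀ x ∈ P', ρ g x = ρ h x) → ∀ x ∈ P, ρ g x = ρ h x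

/-- `g(P)` is determined by `g(P')` for all `g ∈ G`. -/
def ImageDetermines (ρ : Representation ℝ G T) (P' P : Submodule ℝ T) : Prop :=
  ∀ g h : G, P'.map (ρ g) = P'.map (ρ h) → P.map (ρ g) = P.map (ρ h)

/-- The two notions of special subspace in use: one formulated with restrictions of the group
elements to subspaces, the other with images of subspaces under the group elements. -/
inductive SpecialNotion where
  | restriction
  | image

/-- `P` is a special subspace of the representation `ρ`, in either of the two senses. The
subspace `P'` is a generating subspace of `P`. -/
def IsSpecialSubspace (ρ : Representation ℝ G T) (P : Submodule ℝ T) : SpecialNotion → Prop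
  | .restriction => ∃ P' : Submodule ℝ T, P' < P ∧ RestrictionDetermines ρ P' P ∧
      ∀ P'' : Submodule ℝ T, P ≤ P'' → RestrictionDetermines ρ P' P'' → P'' = P
  | .image => ∃ P' : Submodule ℝ T, P' < P ∧ ImageDetermines ρ P' P ∧
      ∀ P'' : Submodule ℝ T, P' < P'' → P'' ≤ P → ImageDetermines ρ P' P'' → P'' = P

/-- `P` is a special subspace of minimal dimension. -/
def IsMinimalSpecialSubspace (k : SpecialNotion) (ρ : Representation ℝ G T)
    (P : Submodule ℝ T) : Prop :=
  IsSpecialSubspace ρ P k ∧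
    ∀ Q : Submodule ℝ T, IsSpecialSubspace ρ Q k → Module.finrank ℝ P ≤ Module.finrank ℝ Q

end Special

/-! ### The round sphere -/

/-- Euclidean space `ℝⁿ`. -/
abbrev Euc (n : ℕ) : Type := EuclideanSpace ℝ (Fin n)

/-- The unit sphere `Sⁿ` in `ℝⁿ⁺¹`. -/
abbrev Sph (n : ℕ) : Type := Metric.sphere (0 : Euc (n + 1)) 1

/-- The tangent space `T_p Sⁿ`, the orthogonal complement of `p`; its inner product, restricted
from `ℝⁿ⁺¹`, is the standard metric. -/
abbrev Tan {n : ℕ} (p : Sph n) : Submodule ℝ (Euc (n + 1)) := (ℝ ∙ (p : Euc (n + 1)))ᗮ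

/-- Smooth vector fields on `Sⁿ`, given by smooth extensions to `ℝⁿ⁺¹`. -/
structure IsTangentField {n : ℕ} (X : Euc (n + 1) → Euc (n + 1)) : Prop where
  smooth : ContDiff ℝ ∞ X
  tangent : ∀ p : Sph n, X p ∈ Tan p

/-- The Levi-Civita connection of the round sphere: `(∇_X Y)_p` is the tangential part of the
derivative of `Y` in the direction `X_p`. The lemmas `sphereConn_gauss`, `sphereConn_metric` and
`sphereConn_torsion` below confirm that it is metric and torsion-free. -/
def sphereConn {n : ℕ} (X Y : Euc (n + 1) → Euc (n + 1)) (p : Sph n) : Euc (n + 1) :=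
  (Tan p).starProjection (fderiv ℝ Y p (X p))

/-- `X` is a vector field along the curve `γ` on `[a, b]` (with values in the tangent spaces of
the sphere) which is parallel: the tangential part of `dX/dt` vanishes. -/
def IsParallelAlong {n : ℕ} (γ : ℝ → Sph n) (a b : ℝ) (X : ℝ → Euc (n + 1)) : Prop :=
  DifferentiableOn ℝ X (Set.Icc a b) ∧
    ∀ t ∈ Set.Icc a b, X t ∈ Tan (γ t) ∧
      (Tan (γ t)).starProjection (derivWithin X (Set.Icc a b) t) = 0

lemma mem_Tan {n : ℕ} {p : Sph n} {v : Euc (n + 1)} :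
    v ∈ Tan p ↔ ⟪(p : Euc (n + 1)), v⟫ = 0 :=
  Submodule.mem_orthogonal_singleton_iff_inner_right

/-- A differentiable function that is zero on the sphere has zero tangential derivatives. -/
lemma fderiv_tangent_eq_zero {n : ℕ} {f : Euc (n + 1) → ℝ} (hf : Differentiable ℝ f)
    (h0 : ∀ q : Sph n, f q = 0) (p : Sph n) {v : Euc (n + 1)} (hv : v ∈ Tan p) :
    fderiv ℝ f p v = 0 := by
  by_cases hv0 : v = 0
  · simp [hv0]
  have hn : ‖v‖ ≠ 0 := norm_ne_zero_iff.2 hv0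
  have hp : ‖(p : Euc (n + 1))‖ = 1 := by simp
  have hpv := mem_Tan.1 hv
  let c : ℝ → Euc (n + 1) := fun t => Real.cos t • (p : Euc (n + 1)) + Real.sin t • (‖v‖⁻¹ • v)
  have hc : ∀ t, ‖c t‖ = 1 := by
    intro t
    have h2 : ‖c t‖ ^ 2 = 1 := by
      simp only [c]
      rw [norm_add_sq_real]
      have hw : ‖‖v‖⁻¹ • v‖ = 1 := norm_smul_inv_norm hv0
      rw [norm_smul, norm_smul (Real.sin t), hw, hp]
      simp only [inner_smul_left, inner_smul_right, hpv, Real.norm_eq_abs, mul_one, sq_abs,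
        mul_zero, add_zero]
      exact Real.cos_sq_add_sin_sq t
    have := norm_nonneg (c t)
    nlinarith
  have hd : HasDerivAt c (‖v‖⁻¹ • v) 0 := by
    have h1 := (Real.hasDerivAt_cos 0).smul_const (p : Euc (n + 1))
    have h2 := (Real.hasDerivAt_sin 0).smul_const (‖v‖⁻¹ • v)
    refine (h1.add h2).congr_deriv ?_
    simp
  have hc0 : c 0 = p := by simp [c]
  have h3 : HasDerivAt (f ∘ c) (fderiv ℝ f (c 0) (‖v‖⁻¹ • v)) 0 :=
    (hf (c 0)).hasFDerivAt.comp_hasDerivAt 0 hd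
  have h4 : f ∘ c = fun _ => 0 := by
    funext t
    exact h0 ⟨c t, by simp [hc t]⟩
  rw [h4, hc0] at h3
  have h5 := h3.unique (hasDerivAt_const (0 : ℝ) (0 : ℝ))
  rw [map_smul, smul_eq_mul] at h5
  rcases mul_eq_zero.1 h5 with h | h
  · exact absurd h (inv_ne_zero hn)
  · exact h

/-- The Gauss formula `∇'_X Y = ∇_X Y - ⟨X, Y⟩ x` for the sphere. -/
lemma sphereConn_gauss {n : ℕ} {X Y : Euc (n + 1) → Euc (n + 1)} (hX : IsTangentField X)
    (hY : IsTangentField Y) (p : Sph n) :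
    fderiv ℝ Y p (X p) = sphereConn X Y p - ⟪X p, Y p⟫ • (p : Euc (n + 1)) := by
  have hYd : Differentiable ℝ Y := hY.smooth.differentiable (by simp)
  have h := fderiv_tangent_eq_zero (f := fun y => ⟪y, Y y⟫)
    (differentiable_id.inner ℝ hYd) (fun q => mem_Tan.1 (hY.tangent q)) p (hX.tangent p)
  rw [fderiv_inner_apply ℝ differentiableAt_fun_id (hYd _)] at h
  have hp : ‖(p : Euc (n + 1))‖ = 1 := by simp
  simp only [fderiv_fun_id, ContinuousLinearMap.id_apply] at h
  have h1 : (Tan p).starProjection (fderiv ℝ Y p (X p)) =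
      fderiv ℝ Y p (X p) - ⟪(p : Euc (n + 1)), fderiv ℝ Y p (X p)⟫ • (p : Euc (n + 1)) := by
    rw [Submodule.starProjection_orthogonal_val, Submodule.starProjection_unit_singleton ℝ hp]
  rw [sphereConn, h1, sub_sub, ← add_smul, h, zero_smul, sub_zero]

/-- The connection `sphereConn` is compatible with the metric. -/
lemma sphereConn_metric {n : ℕ} {X Y Z : Euc (n + 1) → Euc (n + 1)} (hX : IsTangentField X)
    (hY : IsTangentField Y) (hZ : IsTangentField Z) (p : Sph n) :
    fderiv ℝ (fun y => ⟪Y y, Z y⟫) p (X p) =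
      ⟪sphereConn X Y p, Z p⟫ + ⟪Y p, sphereConn X Z p⟫ := by
  rw [fderiv_inner_apply ℝ (hY.smooth.differentiable (by simp) _)
    (hZ.smooth.differentiable (by simp) _), sphereConn_gauss hX hY, sphereConn_gauss hX hZ,
    inner_sub_left, inner_sub_right, inner_smul_left, inner_smul_right,
    mem_Tan.1 (hZ.tangent p), real_inner_comm (p : Euc (n + 1)) (Y p),
    mem_Tan.1 (hY.tangent p)]
  simp [add_comm]

/-- The connection `sphereConn` is torsion-free. -/
lemma sphereConn_torsion {n : ℕ} {X Y : Euc (n + 1) → Euc (n + 1)} (hX : IsTangentField X)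
    (hY : IsTangentField Y) (p : Sph n) :
    sphereConn X Y p - sphereConn Y X p = VectorField.lieBracket ℝ X Y p := by
  rw [VectorField.lieBracket, sphereConn_gauss hX hY, sphereConn_gauss hY hX,
    real_inner_comm]
  abel

/-! ### Reductions of the structure group and weak holonomy -/

section WeakHolonomy

variable {n : ℕ}

/-- Orthonormal frames of the sphere at `p`, as linear isometries from `ℝⁿ` onto `T_p Sⁿ`. -/
abbrev OFrame (p : Sph n) : Type := Euc n ≃ₗᵢ[ℝ] Tan p

/-- The family `F` of sets of orthonormal frames is a reduction of the structure group to `G`: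
it has smooth local sections and each fibre is an orbit of the (free) right action of `G` on the
orthonormal frames. -/
def IsReduction (G : Subgroup (Euc n ≃ₗᵢ[ℝ] Euc n)) (F : ∀ p : Sph n, Set (OFrame p)) : Prop :=
  (∀ p : Sph n, ∃ U : Set (Euc (n + 1)), IsOpen U ∧ (p : Euc (n + 1)) ∈ U ∧
    ∃ s : Euc (n + 1) → Euc n →L[ℝ] Euc (n + 1), ContDiffOn ℝ ∞ s U ∧
      ∀ q : Sph n, (q : Euc (n + 1)) ∈ U → ∃ u ∈ F q, ∀ a, s q a = (u a : Euc (n + 1))) ∧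
  ∀ p : Sph n, ∀ u ∈ F p, ∀ v : OFrame p, v ∈ F p ↔ ∃ g ∈ G, ∀ a, v a = u (g a)

/-- The representation of `G` on `T_p Sⁿ` obtained by means of the frame `u`. -/
def frameRep (G : Subgroup (Euc n ≃ₗᵢ[ℝ] Euc n)) {p : Sph n} (u : OFrame p) :
    Representation ℝ G (Tan p) where
  toFun g := u.toLinearEquiv.toLinearMap ∘ₗ g.1.toLinearEquiv.toLinearMap ∘ₗ
    u.symm.toLinearEquiv.toLinearMap
  map_one' := by ext; simp
  map_mul' g h := by ext; simp

/-- `γ` is a smooth loop `[0, 1] → Sⁿ` based at `p`. -/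
structure IsLoopAt (p : Sph n) (γ : ℝ → Sph n) : Prop where
  smooth : ContDiffOn ℝ ∞ (fun t => (γ t : Euc (n + 1))) (Set.Icc 0 1)
  source : γ 0 = p
  target : γ 1 = p

/-- `G` is a weak holonomy group of the round sphere with the reduction `F` of the structure group
to `G`: for each loop `γ` at `p` there is `g ∈ G` such that the parallel translation along `γ`
agrees with `g` on each special subspace `P` of minimal dimension that contains `γ'(0)`. -/
def IsWeakHolonomyGroup (k : SpecialNotion) (G : Subgroup (Euc n ≃ₗᵢ[ℝ] Euc n))
    (F : ∀ p : Sph n, Set (OFrame p)) : Prop :=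
  ∀ p : Sph n, ∀ u ∈ F p, ∀ γ : ℝ → Sph n, IsLoopAt p γ →
    ∃ g : G, ∀ P : Submodule ℝ (Tan p), IsMinimalSpecialSubspace k (frameRep G u) P →
      (∃ v ∈ P, (v : Euc (n + 1)) =
        derivWithin (fun t => (γ t : Euc (n + 1))) (Set.Icc 0 1) 0) →
      ∀ X : ℝ → Euc (n + 1), IsParallelAlong γ 0 1 X →
        ∀ v ∈ P, X 0 = (v : Euc (n + 1)) → X 1 = (frameRep G u g v : Euc (n + 1))

end WeakHolonomy

/-! ### The forms, the group `G₂` and the cross product on the 7-sphere -/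

/-- The form `e^{i₁} ∧ ⋯ ∧ e^{iₖ}` on `ℝⁿ`; the indices run from `0` to `n - 1`. -/
def eForm {n k : ℕ} (i : Fin k → Fin n) : Euc n [⋀^Fin k]→ₗ[ℝ] ℝ :=
  Matrix.detRowAlternating.compLinearMap
    (LinearMap.pi fun b => (EuclideanSpace.proj (𝕜 := ℝ) (i b)).toLinearMap)

/-- `e^{123} + e^{145} - e^{167} + e^{246} + e^{257} + e^{347} - e^{356}` on `ℝ⁷`. -/
def phi0 : Euc 7 [⋀^Fin 3]→ₗ[ℝ] ℝ :=
  eForm ![0, 1, 2] + eForm ![0, 3, 4] - eForm ![0, 5, 6] + eForm ![1, 3, 5] + eForm ![1, 4, 6]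
    + eForm ![2, 3, 6] - eForm ![2, 4, 5]

/-- The 4-form `e^{1234} + e^{1256} - e^{1278} + e^{1357} + e^{1368} + e^{1458} - e^{1467}
+ e^{5678} - e^{3456} + e^{2457} - e^{2358} + e^{2367} + e^{3478} + e^{2468}` on `ℝ⁸`. -/
def theta : Euc 8 [⋀^Fin 4]→ₗ[ℝ] ℝ :=
  eForm ![0, 1, 2, 3] + eForm ![0, 1, 4, 5] - eForm ![0, 1, 6, 7] + eForm ![0, 2, 4, 6]
    + eForm ![0, 2, 5, 7] + eForm ![0, 3, 4, 7] - eForm ![0, 3, 5, 6]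
    + eForm ![4, 5, 6, 7] - eForm ![2, 3, 4, 5] + eForm ![1, 3, 4, 6] - eForm ![1, 2, 4, 7]
    + eForm ![1, 2, 5, 6] + eForm ![2, 3, 6, 7] + eForm ![1, 3, 5, 7]

/-- `G₂`, the subgroup of `SO(7)` of all elements that preserve `phi0`. -/
def G2 : Subgroup (Euc 7 ≃ₗᵢ[ℝ] Euc 7) where
  carrier := {g | LinearMap.det (g.toLinearEquiv : Euc 7 →ₗ[ℝ] Euc 7) = 1 ∧
    ∀ x y z, phi0 ![g x, g y, g z] = phi0 ![x, y, z]}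
  one_mem' := ⟨LinearMap.det_id, fun _ _ _ => rfl⟩
  mul_mem' := by
    rintro g h ⟨hg, hg'⟩ ⟨hh, hh'⟩
    refine ⟨?_, fun x y z => ?_⟩
    · have h1 : ((g * h).toLinearEquiv : Euc 7 →ₗ[ℝ] Euc 7) =
          (g.toLinearEquiv : Euc 7 →ₗ[ℝ] Euc 7) ∘ₗ (h.toLinearEquiv : Euc 7 →ₗ[ℝ] Euc 7) := rfl
      rw [h1, LinearMap.det_comp, hg, hh, one_mul]
    · exact (hg' _ _ _).trans (hh' _ _ _)
  inv_mem' := by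
    rintro g ⟨hg, hg'⟩
    refine ⟨?_, fun x y z => ?_⟩
    · have h1 : LinearMap.det ((g⁻¹).toLinearEquiv : Euc 7 →ₗ[ℝ] Euc 7) *
          LinearMap.det (g.toLinearEquiv : Euc 7 →ₗ[ℝ] Euc 7) = 1 :=
        LinearEquiv.det_symm_mul_det g.toLinearEquiv
      rwa [hg, mul_one] at h1
    · have h1 := hg' (g⁻¹ x) (g⁻¹ y) (g⁻¹ z)
      have h2 : ∀ w, g (g⁻¹ w) = w := fun w => g.apply_symm_apply w
      rw [h2, h2, h2] at h1
      exact h1.symm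

/-- The 3-form `φ_x(X, Y, Z) = θ(x, X, Y, Z)`, on `S⁷` for `x ∈ S⁷` and tangent `X`, `Y`, `Z`. -/
def phi (x X Y Z : Euc 8) : ℝ := theta ![x, X, Y, Z]

/-- The vector cross product `Φ`, with `⟨Φ_x(X, Y), Z⟩ = φ_x(X, Y, Z)`. -/
def Phi (x X Y : Euc 8) : Euc 8 :=
  WithLp.toLp 2 fun i => phi x X Y (EuclideanSpace.single i 1)

/-- The orthonormal frames of `S⁷` that identify `phi0` with `φ`. -/
def G2Frames (p : Sph 7) : Set (OFrame p) :=
  {u | ∀ a b c : Euc 7, phi p (u a) (u b) (u c) = phi0 ![a, b, c]}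

/-- `(∇_V φ)(X, Y, Z)` at `p`. -/
def covPhi (V X Y Z : Euc 8 → Euc 8) (p : Sph 7) : ℝ :=
  fderiv ℝ (fun y => phi y (X y) (Y y) (Z y)) p (V p) - phi p (sphereConn V X p) (Y p) (Z p)
    - phi p (X p) (sphereConn V Y p) (Z p) - phi p (X p) (Y p) (sphereConn V Z p)

/-- `(∇_V Φ)(X, Y)` at `p`. -/
def covCross (V X Y : Euc 8 → Euc 8) (p : Sph 7) : Euc 8 :=
  sphereConn V (fun y => Phi y (X y) (Y y)) p - Phi p (sphereConn V X p) (Y p)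
    - Phi p (X p) (sphereConn V Y p)

/-! ### The explicit loop and the explicit fields along it -/

/-- The circle `x_t = (r cos t, r sin t, 0, √(1 - r²), 0, 0, 0, 0)` on `S⁷`. -/
def xCurve (r : ℝ) (hr : r ∈ Set.Ioo (0 : ℝ) 1) (t : ℝ) : Sph 7 :=
  ⟨!₂[r * Real.cos t, r * Real.sin t, 0, √(1 - r ^ 2), 0, 0, 0, 0], by
    have h : 0 ≤ 1 - r ^ 2 := by nlinarith [hr.1, hr.2]
    have h2 : (r * Real.cos t) ^ 2 + (r * Real.sin t) ^ 2 = r ^ 2 := by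
      linear_combination r ^ 2 * Real.cos_sq_add_sin_sq t
    simp [EuclideanSpace.norm_eq, Fin.sum_univ_eight, Real.sq_sqrt h, h2]⟩

/-- The field `X_t` along the circle. -/
def xField (r t : ℝ) : Euc 8 :=
  let s := √(1 - r ^ 2)
  !₂[- (r ^ 3 * Real.sin ((1 + s) * t) / (2 * (1 + s)))
      - r ^ 3 * Real.sin ((1 - s) * t) / (2 * (1 - s)),
    r ^ 3 * Real.cos ((1 + s) * t) / (2 * (1 + s))
      + r ^ 3 * Real.cos ((1 - s) * t) / (2 * (1 - s)),
    0, - (r ^ 2 * Real.sin (s * t)), 0, 0, 0, 0]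

/-- The constant field `Y_t` along the circle. -/
def yField (r _t : ℝ) : Euc 8 :=
  !₂[0, 0, r ^ 2, 0, 0, - (r * √(1 - r ^ 2)), 0, 0]

/-- The field `Z_t` along the circle. -/
def zField (r t : ℝ) : Euc 8 :=
  let s := √(1 - r ^ 2)
  !₂[r ^ 5 * Real.cos ((1 + s) * t) / (2 * (1 + s))
      - r ^ 5 * Real.cos ((1 - s) * t) / (2 * (1 - s)),
    r ^ 5 * Real.sin ((1 + s) * t) / (2 * (1 + s))
      - r ^ 5 * Real.sin ((1 - s) * t) / (2 * (1 - s)),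
    0, r ^ 4 * Real.cos (s * t), r ^ 3 * s, 0, 0, r ^ 2 * (1 - r ^ 2)]

/-- The span of `X₀`, `Y₀`, `Z₀` as a subspace of the tangent space at the point `x₀`. -/
def loopSpan (r : ℝ) (hr : r ∈ Set.Ioo (0 : ℝ) 1) : Submodule ℝ (Tan (xCurve r hr 0)) :=
  (Submodule.span ℝ {xField r 0, yField r 0, zField r 0}).comap (Tan (xCurve r hr 0)).subtype

end

/-! The form `theta` defines a triple cross product on `ℝ⁸`: the squared norm of `Phi x X Y` is the
Gram determinant of `x`, `X`, `Y` (`norm_sq_Phi`). With `x` on the sphere and `X`, `Y` tangent, this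
is the norm condition for a vector cross product.

Near-parallelism is pure alternation (`fderiv_Phi_self`). Differentiating `Φ_y(X, Y)` in the
direction `X` produces the base point term `Φ_X(X, Y) = 0`, and the normal parts given by the Gauss
formula are multiples of the base point, which `Φ_p` kills.

In dimension 7 a cross product is generated by a basic triple: its multiplication table is forced
(`crossFrame_table`) and is that of `phi0` (`inner_crossFrame`). Hence adapted frames exist, and the
automorphisms act transitively on basic triples (`exists_preservesCross`). They automatically have
determinant 1 (`PreservesCross.det_eq_one`), so in an adapted frame they form exactly `G2`.
Transitivity also determines the special subspaces that matter: fixing one vector leaves an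
orthogonal one free to move, so dimension at most 2 is impossible, whereas fixing `a` and `b` fixes
their product and nothing orthogonal to all three. Thus `span {a, b, m a b}` is special of minimal
dimension (`isMinimalSpecialSubspace_span`).

If `G2` were a weak holonomy group, parallel translation along the circle would agree on `span {X₀,
Y₀, Z₀}` with an automorphism and so preserve the relation `Z = Φ(X, Y)`. The fifth coordinate of
`Z` stays `r³s`, while that of `Φ(X, Y)` at time `2π` is `r³s cos(2πs)`; these differ because `0 < s
< 1` (`zField_two_pi_ne`). -/

/-! ### Coordinate formulas for the forms. -/

lemma eForm_apply {n k : ℕ} (i : Fin k → Fin n) (v : Fin k → Euc n) :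
    eForm i v = Matrix.det (Matrix.of fun a b => v a (i b)) := rfl

lemma eForm_three_apply {n : ℕ} (i j k : Fin n) (x y z : Euc n) :
    eForm ![i, j, k] ![x, y, z] = x i * (y j * z k - y k * z j)
      - x j * (y i * z k - y k * z i) + x k * (y i * z j - y j * z i) := by
  rw [eForm_apply]
  simp [Matrix.det_succ_row_zero, Fin.sum_univ_succ, Fin.succAbove]
  ring

lemma eForm_four_apply {n : ℕ} (i j k l : Fin n) (w x y z : Euc n) :
    eForm ![i, j, k, l] ![w, x, y, z] =
      w i * (x j * (y k * z l - y l * z k) - x k * (y j * z l - y l * z j)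
        + x l * (y j * z k - y k * z j))
      - w j * (x i * (y k * z l - y l * z k) - x k * (y i * z l - y l * z i)
        + x l * (y i * z k - y k * z i))
      + w k * (x i * (y j * z l - y l * z j) - x j * (y i * z l - y l * z i)
        + x l * (y i * z j - y j * z i))
      - w l * (x i * (y j * z k - y k * z j) - x j * (y i * z k - y k * z i)
        + x k * (y i * z j - y j * z i)) := by
  rw [eForm_apply]
  simp [Matrix.det_succ_row_zero, Fin.sum_univ_succ, Fin.succAbove]
  ring

/-- `phi` as the inner product with `Phi`, in coordinates. -/
lemma phi_apply (x X Y Z : Euc 8) : phi x X Y Z = ∑ i, Phi x X Y i * Z i := by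
  simp only [Phi, phi, theta, AlternatingMap.add_apply, AlternatingMap.sub_apply,
    eForm_four_apply, Fin.sum_univ_eight, PiLp.single_apply]
  simp only [Fin.reduceEq, if_true, if_false, mul_zero, mul_one, sub_zero, zero_sub, add_zero,
    zero_add]
  ring

/-- The right side is the Gram determinant of `x`, `X`, `Y`. This is a polynomial identity in 24
coordinates, and the only place where the particular signs in `theta` enter the cross product
axioms. -/
lemma norm_sq_Phi (x X Y : Euc 8) : ‖Phi x X Y‖ ^ 2 =
    ‖x‖ ^ 2 * (‖X‖ ^ 2 * ‖Y‖ ^ 2 - ⟪X, Y⟫ ^ 2) - ⟪x, X⟫ * (⟪x, X⟫ * ‖Y‖ ^ 2 - ⟪X, Y⟫ * ⟪x, Y⟫)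
      + ⟪x, Y⟫ * (⟪x, X⟫ * ⟪X, Y⟫ - ‖X‖ ^ 2 * ⟪x, Y⟫) := by
  simp only [EuclideanSpace.norm_sq_eq, Real.norm_eq_abs, sq_abs, PiLp.inner_apply,
    Fin.sum_univ_eight, RCLike.inner_apply, conj_trivial]
  simp only [Phi, phi, theta, AlternatingMap.add_apply, AlternatingMap.sub_apply,
    eForm_four_apply, PiLp.single_apply]
  simp only [Fin.reduceEq, if_true, if_false, mul_zero, mul_one, sub_zero, zero_sub, add_zero,
    zero_add]
  ring

/-! ### Vector cross products -/

section Cross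

variable {V : Type*} [NormedAddCommGroup V] [InnerProductSpace ℝ V]

/-- `m` is a vector cross product on the inner product space `V`. -/
structure IsCrossProduct (m : V →ₗ[ℝ] V →ₗ[ℝ] V) : Prop where
  anti : ∀ a b, m a b = -m b a
  cyclic : ∀ a b c, ⟪m a b, c⟫ = ⟪m b c, a⟫
  norm_sq : ∀ a b, ‖m a b‖ ^ 2 = ‖a‖ ^ 2 * ‖b‖ ^ 2 - ⟪a, b⟫ ^ 2

namespace IsCrossProduct

variable {m : V →ₗ[ℝ] V →ₗ[ℝ] V} (hm : IsCrossProduct m)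
include hm

lemma apply_self (a : V) : m a a = 0 := by
  have h := hm.anti a a
  rwa [eq_neg_iff_add_eq_zero, ← two_smul ℝ, smul_eq_zero_iff_right two_ne_zero] at h

lemma inner_left (a b : V) : ⟪m a b, a⟫ = 0 := by
  rw [← hm.cyclic a a b, hm.apply_self, inner_zero_left]

lemma inner_right (a b : V) : ⟪m a b, b⟫ = 0 := by
  rw [hm.cyclic, hm.apply_self, inner_zero_left]

lemma inner_left_comm (a b c : V) : ⟪m a b, c⟫ = -⟪b, m a c⟫ := by
  rw [hm.cyclic, hm.cyclic, hm.anti c a, inner_neg_left, real_inner_comm]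

/-- Polarization of `norm_sq` in the second argument. -/
lemma inner_apply_apply (a b c : V) :
    ⟪m a b, m a c⟫ = ‖a‖ ^ 2 * ⟪b, c⟫ - ⟪a, b⟫ * ⟪a, c⟫ := by
  have h1 := hm.norm_sq a (b + c)
  rw [map_add, norm_add_sq_real, hm.norm_sq, hm.norm_sq, norm_add_sq_real, inner_add_right] at h1
  linarith

lemma apply_apply_self (a b : V) : m a (m a b) = ⟪a, b⟫ • a - ‖a‖ ^ 2 • b := by
  refine ext_inner_right ℝ fun c => ?_
  rw [hm.inner_left_comm, hm.inner_apply_apply, inner_sub_left, inner_smul_left, inner_smul_left]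
  simp

/-- Polarization of `apply_apply_self` in `a`: the Clifford relation, up to terms that vanish for
orthogonal vectors. -/
lemma apply_apply_add (a b c : V) :
    m a (m b c) + m b (m a c) = ⟪a, c⟫ • b + ⟪b, c⟫ • a - (2 * ⟪a, b⟫) • c := by
  have h1 := hm.apply_apply_self (a + b) c
  simp only [map_add, LinearMap.add_apply, hm.apply_apply_self, norm_add_sq_real,
    inner_add_left] at h1
  linear_combination (norm := module) h1

lemma apply_apply_of_orthogonal {a b c : V} (hab : ⟪a, b⟫ = 0) (hac : ⟪a, c⟫ = 0)
    (hbc : ⟪b, c⟫ = 0) : m a (m b c) = -m b (m a c) := by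
  have h := hm.apply_apply_add a b c
  rw [hab, hac, hbc] at h
  simpa [add_eq_zero_iff_eq_neg] using h

lemma apply_apply_of_unit {a b : V} (ha : ‖a‖ = 1) (hab : ⟪a, b⟫ = 0) : m a (m a b) = -b := by
  rw [hm.apply_apply_self, ha, hab]
  simp

lemma norm_eq_one {a b : V} (ha : ‖a‖ = 1) (hb : ‖b‖ = 1) (hab : ⟪a, b⟫ = 0) : ‖m a b‖ = 1 := by
  have h := hm.norm_sq a b
  rw [ha, hb, hab] at h
  have := norm_nonneg (m a b)
  nlinarith

end IsCrossProduct

/-- `a`, `b`, `c` are orthonormal, and `c` is orthogonal to the product of `a` and `b`. -/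
structure IsBasicTriple (m : V →ₗ[ℝ] V →ₗ[ℝ] V) (a b c : V) : Prop where
  norm_fst : ‖a‖ = 1
  norm_snd : ‖b‖ = 1
  norm_trd : ‖c‖ = 1
  inner_fst_snd : ⟪a, b⟫ = 0
  inner_fst_trd : ⟪a, c⟫ = 0
  inner_snd_trd : ⟪b, c⟫ = 0
  inner_apply_trd : ⟪m a b, c⟫ = 0

/-- The seven vectors generated by a basic triple. -/
def crossFrame (m : V →ₗ[ℝ] V →ₗ[ℝ] V) (a b c : V) : Fin 7 → V :=
  ![a, b, m a b, c, m a c, m b c, m (m a b) c]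

/-! ### The multiplication table generated by a basic triple. -/

section Table

variable {m : V →ₗ[ℝ] V →ₗ[ℝ] V} (hm : IsCrossProduct m) {a b c : V} (h : IsBasicTriple m a b c)
include hm h

/-- Up to order there are 21 products of distinct frame vectors; four define `d`, `e`, `f`, `g`, and
these are the other 17. They all follow from two facts: multiplication by a unit vector squares to
`-1` on its orthogonal complement, and multiplications by orthogonal vectors anticommute on vectors
orthogonal to both. -/
lemma crossFrame_table (d e f g : V) (hd : m a b = d) (he : m a c = e) (hf : m b c = f)
    (hg : m d c = g) :
    (m a d = -b ∧ m b d = a ∧ m a e = -c ∧ m c e = a ∧ m b f = -c ∧ m c f = b ∧ m d g = -c ∧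
      m c g = d) ∧ m b e = g ∧ m a f = -g ∧ m a g = f ∧ m d e = -f ∧ m b g = -e ∧ m e f = -d ∧
      m d f = e ∧ m e g = b ∧ m f g = -a := by
  obtain ⟨ha, hb, hc, hab, hac, hbc, habc⟩ := h
  have hba : ⟪b, a⟫ = 0 := by rw [real_inner_comm, hab]
  have hca : ⟪c, a⟫ = 0 := by rw [real_inner_comm, hac]
  have hcb : ⟪c, b⟫ = 0 := by rw [real_inner_comm, hbc]
  have hnd : ‖d‖ = 1 := hd ▸ hm.norm_eq_one ha hb hab
  have hdc : ⟪d, c⟫ = 0 := hd ▸ habc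
  have hda : ⟪d, a⟫ = 0 := hd ▸ hm.inner_left a b
  have hne : ‖e‖ = 1 := he ▸ hm.norm_eq_one ha hc hac
  have hnf : ‖f‖ = 1 := hf ▸ hm.norm_eq_one hb hc hbc
  have hea : ⟪e, a⟫ = 0 := he ▸ hm.inner_left a c
  have heb : ⟪e, b⟫ = 0 := by
    rw [← he, hm.cyclic, hm.anti c b, hf, inner_neg_left, ← hf, ← hm.cyclic a b c, habc, neg_zero]
  have hfa : ⟪f, a⟫ = 0 := by rw [← hf, ← hm.cyclic a b c, habc]
  have hed : ⟪e, d⟫ = 0 := by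
    rw [← he, ← hd, hm.inner_apply_apply, hcb, hab, mul_zero, mul_zero, sub_zero]
  have hbd' : m b a = -d := by rw [hm.anti, hd]
  have hca' : m c a = -e := by rw [hm.anti, he]
  have hcb' : m c b = -f := by rw [hm.anti, hf]
  have hcd' : m c d = -g := by rw [hm.anti, hg]
  have t1 : m a d = -b := by rw [← hd, hm.apply_apply_of_unit ha hab]
  have t2 : m b d = a := by
    rw [← neg_neg d, ← hbd', map_neg, hm.apply_apply_of_unit hb hba, neg_neg]
  have t3 : m a e = -c := by rw [← he, hm.apply_apply_of_unit ha hac]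
  have t4 : m c e = a := by
    rw [← neg_neg e, ← hca', map_neg, hm.apply_apply_of_unit hc hca, neg_neg]
  have t5 : m b f = -c := by rw [← hf, hm.apply_apply_of_unit hb hbc]
  have t6 : m c f = b := by
    rw [← neg_neg f, ← hcb', map_neg, hm.apply_apply_of_unit hc hcb, neg_neg]
  have t7 : m d g = -c := by rw [← hg, hm.apply_apply_of_unit hnd hdc]
  have t8 : m c g = d := by
    rw [← neg_neg g, ← hcd', map_neg, hm.apply_apply_of_unit hc (by rw [real_inner_comm, hdc]),
      neg_neg]
  have u1 : m b e = g := by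
    have h1 := hm.apply_apply_of_orthogonal hcb hca hba
    rw [hbd', hca', map_neg, map_neg, hcd', neg_neg, neg_neg] at h1
    exact h1.symm
  have u2 : m a f = -g := by
    have h1 := hm.apply_apply_of_orthogonal hab hac hbc
    rwa [hf, he, u1] at h1
  have haf : ⟪a, f⟫ = 0 := by rw [real_inner_comm, hfa]
  have hbe : ⟪b, e⟫ = 0 := by rw [real_inner_comm, heb]
  have u3 : m a g = f := by
    rw [← neg_neg g, ← u2, map_neg, hm.apply_apply_of_unit ha haf, neg_neg]
  have u4 : m d e = -f := by
    have h1 := hm.apply_apply_of_orthogonal (a := a) (b := d) (c := c)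
      (by rw [real_inner_comm, hda]) hac hdc
    rw [hg, he, u3] at h1
    rw [h1, neg_neg]
  have u5 : m b g = -e := by rw [← u1, hm.apply_apply_of_unit hb hbe]
  have hed' : m e d = f := by rw [hm.anti, u4, neg_neg]
  have u6 : m e f = -d := by rw [← hed', hm.apply_apply_of_unit hne hed]
  have u7 : m d f = e := by
    rw [← neg_neg f, ← u4, map_neg,
      hm.apply_apply_of_unit hnd (by rw [real_inner_comm, hed]), neg_neg]
  have heb' : m e b = -g := by rw [hm.anti, u1]
  have hfa' : m f a = g := by rw [hm.anti, u2, neg_neg]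
  have u8 : m e g = b := by
    rw [← neg_neg g, ← heb', map_neg, hm.apply_apply_of_unit hne heb, neg_neg]
  have u9 : m f g = -a := by
    rw [← hfa', hm.apply_apply_of_unit hnf hfa]
  exact ⟨⟨t1, t2, t3, t4, t5, t6, t7, t8⟩, u1, u2, u3, u4, u5, u6, u7, u8, u9⟩

lemma orthonormal_crossFrame : Orthonormal ℝ (crossFrame m a b c) := by
  obtain ⟨⟨t1, t2, t3, t4, t5, t6, t7, t8⟩, u1, u2, u3, u4, u5, u6, u7, u8, u9⟩ :=
    crossFrame_table hm h _ _ _ _ rfl rfl rfl rfl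
  obtain ⟨ha, hb, hc, hab, hac, hbc, habc⟩ := h
  have hd := hm.norm_eq_one ha hb hab
  have key : ∀ i j : Fin 7, i < j → ⟪crossFrame m a b c i, crossFrame m a b c j⟫ = 0 := by
    have flip : ∀ x y : V, ⟪m x y, x⟫ = 0 ∧ ⟪m x y, y⟫ = 0 ∧ ⟪x, m x y⟫ = 0 ∧ ⟪y, m x y⟫ = 0 :=
      fun x y => ⟨hm.inner_left x y, hm.inner_right x y,
        by rw [real_inner_comm, hm.inner_left], by rw [real_inner_comm, hm.inner_right]⟩
    have haf : ⟪a, m b c⟫ = 0 := by rw [real_inner_comm, ← hm.cyclic, habc]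
    have hbe : ⟪b, m a c⟫ = 0 := by rw [real_inner_comm, hm.cyclic, hm.anti, inner_neg_left,
      real_inner_comm, haf, neg_zero]
    -- By the table the last frame vector is also, up to sign, a product with factor `a` and one
    -- with factor `b`. For two products with a common factor, `inner_apply_apply` reduces to inner
    -- products of the factors.
    have hag : ⟪a, m (m a b) c⟫ = 0 := by
      rw [← neg_neg (m (m a b) c), ← u2, inner_neg_right, (flip a _).2.2.1, neg_zero]
    have hbg : ⟪b, m (m a b) c⟫ = 0 := by rw [← u1, (flip b _).2.2.1]
    have hde : ⟪m a b, m a c⟫ = 0 := by simp [hm.inner_apply_apply, hbc, hab]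
    have hdf : ⟪m a b, m b c⟫ = 0 := by
      rw [hm.anti a b, inner_neg_left, hm.inner_apply_apply]
      simp [hac, hbc]
    have hef : ⟪m a c, m b c⟫ = 0 := by
      rw [hm.anti a c, hm.anti b c, inner_neg_neg, hm.inner_apply_apply, hab,
        real_inner_comm, hac]
      simp
    have heg : ⟪m a c, m (m a b) c⟫ = 0 := by
      rw [hm.anti a c, hm.anti _ c, inner_neg_neg, hm.inner_apply_apply, (flip a b).2.2.1,
        real_inner_comm, hac]
      simp
    have hfg : ⟪m b c, m (m a b) c⟫ = 0 := by
      rw [hm.anti b c, hm.anti _ c, inner_neg_neg, hm.inner_apply_apply, (flip a b).2.2.2,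
        real_inner_comm, hbc]
      simp
    intro i j hij
    fin_cases i <;> fin_cases j <;> first
      | exact absurd hij (by decide)
      | simp [crossFrame, hab, hac, hbc, habc, flip, haf, hbe, hag, hbg, hde, hdf, hef, heg, hfg]
  refine ⟨fun i => ?_, fun i j hij => ?_⟩
  · fin_cases i
    · exact ha
    · exact hb
    · exact hd
    · exact hc
    · exact hm.norm_eq_one ha hc hac
    · exact hm.norm_eq_one hb hc hbc
    · exact hm.norm_eq_one hd hc habc
  · rcases lt_or_gt_of_ne hij with hlt | hlt
    · exact key i j hlt
    · rw [real_inner_comm]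
      exact key j i hlt

lemma inner_crossFrame (x y z : Euc 7) :
    ⟪m (∑ i, x i • crossFrame m a b c i) (∑ i, y i • crossFrame m a b c i),
      ∑ i, z i • crossFrame m a b c i⟫ = phi0 ![x, y, z] := by
  have ho := orthonormal_crossFrame hm h
  obtain ⟨⟨t1, t2, t3, t4, t5, t6, t7, t8⟩, u1, u2, u3, u4, u5, u6, u7, u8, u9⟩ :=
    crossFrame_table hm h _ _ _ _ rfl rfl rfl rfl
  -- The `i`-th entry is `phi0` evaluated at `x`, `y` and the `i`-th basis vector.
  have hprod : m (∑ i, x i • crossFrame m a b c i) (∑ i, y i • crossFrame m a b c i) =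
      ∑ i, (![x 1 * y 2 - x 2 * y 1 + (x 3 * y 4 - x 4 * y 3) - (x 5 * y 6 - x 6 * y 5),
        x 2 * y 0 - x 0 * y 2 + (x 3 * y 5 - x 5 * y 3) + (x 4 * y 6 - x 6 * y 4),
        x 0 * y 1 - x 1 * y 0 + (x 3 * y 6 - x 6 * y 3) - (x 4 * y 5 - x 5 * y 4),
        x 4 * y 0 - x 0 * y 4 + (x 5 * y 1 - x 1 * y 5) + (x 6 * y 2 - x 2 * y 6),
        x 0 * y 3 - x 3 * y 0 + (x 6 * y 1 - x 1 * y 6) - (x 5 * y 2 - x 2 * y 5),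
        x 0 * y 6 - x 6 * y 0 + (x 1 * y 3 - x 3 * y 1) - (x 2 * y 4 - x 4 * y 2),
        x 5 * y 0 - x 0 * y 5 + (x 1 * y 4 - x 4 * y 1) + (x 2 * y 3 - x 3 * y 2)] :
          Fin 7 → ℝ) i • crossFrame m a b c i := by
    have s : ∀ p q r : V, m p q = r → m q p = -r := fun p q r hpq => by rw [hm.anti, hpq]
    simp only [Fin.sum_univ_seven, crossFrame, Matrix.cons_val, map_add, map_smul,
      LinearMap.add_apply, LinearMap.smul_apply, hm.apply_self, t1, t2, t3, t4, t5, t6, t7, t8,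
      u1, u2, u3, u4, u5, u6, u7, u8, u9, s _ _ _ t1, s _ _ _ t2, s _ _ _ t3, s _ _ _ t4,
      s _ _ _ t5, s _ _ _ t6, s _ _ _ t7, s _ _ _ t8, s _ _ _ u1, s _ _ _ u2, s _ _ _ u3,
      s _ _ _ u4, s _ _ _ u5, s _ _ _ u6, s _ _ _ u7, s _ _ _ u8, s _ _ _ u9,
      hm.anti b a, hm.anti c a, hm.anti c b, hm.anti c (m a b)]
    module
  rw [hprod, ho.inner_sum]
  simp only [phi0, AlternatingMap.add_apply, AlternatingMap.sub_apply, eForm_three_apply,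
    Fin.sum_univ_seven, Matrix.cons_val, conj_trivial]
  ring

end Table

end Cross

/-! ### Automorphisms: transitivity on basic triples, and determinant one. -/

section Transitivity

variable {V : Type*} [NormedAddCommGroup V] [InnerProductSpace ℝ V]

lemma exists_unit_orthogonal [FiniteDimensional ℝ V] (W : Submodule ℝ V)
    (hW : Module.finrank ℝ W < Module.finrank ℝ V) : ∃ c : V, ‖c‖ = 1 ∧ ∀ w ∈ W, ⟪w, c⟫ = 0 := by
  have h1 : Wᗮ ≠ ⊥ := by
    intro h
    rw [Submodule.orthogonal_eq_bot_iff] at h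
    rw [h, finrank_top] at hW
    exact lt_irrefl _ hW
  obtain ⟨c, hc, hc0⟩ := Submodule.exists_mem_ne_zero_of_ne_bot h1
  refine ⟨‖c‖⁻¹ • c, norm_smul_inv_norm hc0, fun w hw => ?_⟩
  rw [inner_smul_right, (Submodule.mem_orthogonal W c).1 hc w hw, mul_zero]

/-- An isometry of determinant `-1` has the eigenvalue `-1`. -/
lemma exists_unit_apply_eq_neg [FiniteDimensional ℝ V] (A : V ≃ₗᵢ[ℝ] V)
    (hA : LinearMap.det (A.toLinearEquiv : V →ₗ[ℝ] V) = -1) : ∃ v : V, ‖v‖ = 1 ∧ A v = -v := by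
  let b := stdOrthonormalBasis ℝ V
  let f : V →ₗ[ℝ] V := A.toLinearEquiv
  let M := LinearMap.toMatrix b.toBasis b.toBasis f
  have hMM : M.transpose * M = 1 := by
    ext j k
    have h1 : ∀ i j, M i j = ⟪b i, A (b j)⟫ := by
      intro i j
      simp only [M, LinearMap.toMatrix_apply, OrthonormalBasis.coe_toBasis,
        OrthonormalBasis.coe_toBasis_repr_apply, OrthonormalBasis.repr_apply_apply]
      rfl
    have h2 := b.sum_inner_mul_inner (A (b j)) (A (b k))
    rw [LinearIsometryEquiv.inner_map_map, orthonormal_iff_ite.1 b.orthonormal] at h2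
    rw [Matrix.mul_apply, Matrix.one_apply, ← h2]
    refine Finset.sum_congr rfl fun i _ => ?_
    rw [Matrix.transpose_apply, h1, h1, real_inner_comm (A (b j))]
  have hM : M.det = -1 := by rw [LinearMap.det_toMatrix]; exact hA
  have h0 : (1 + M).det = 0 := by
    -- Taking determinants gives `det (1 + M) = -det (1 + M)`.
    have h1 : 1 + M = (1 + M).transpose * M := by
      rw [Matrix.transpose_add, add_mul, hMM, Matrix.transpose_one, one_mul, add_comm]
    have h2 := congrArg Matrix.det h1
    rw [Matrix.det_mul, Matrix.det_transpose, hM] at h2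
    linarith
  have h1 : LinearMap.det (LinearMap.id + f) = 0 := by
    rw [← LinearMap.det_toMatrix b.toBasis, map_add, LinearMap.toMatrix_id]
    exact h0
  obtain ⟨v, hv, hv0⟩ := Submodule.exists_mem_ne_zero_of_ne_bot
    (LinearMap.bot_lt_ker_of_det_eq_zero h1).ne'
  have hv1 : v + A v = 0 := hv
  refine ⟨‖v‖⁻¹ • v, norm_smul_inv_norm hv0, ?_⟩
  rw [map_smul, eq_neg_of_add_eq_zero_right hv1, smul_neg]

lemma LinearIsometryEquiv.inner_eq_zero_of_apply_eq_neg (A : V ≃ₗᵢ[ℝ] V) {v w : V} (hv : A v = v)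
    (hw : A w = -w) : ⟪v, w⟫ = 0 := by
  have h := A.inner_map_map v w
  rw [hv, hw, inner_neg_right] at h
  linarith

/-- A linear isometry that is compatible with the cross product `m`. -/
def PreservesCross (m : V →ₗ[ℝ] V →ₗ[ℝ] V) (A : V ≃ₗᵢ[ℝ] V) : Prop :=
  ∀ x y, A (m x y) = m (A x) (A y)

variable {m : V →ₗ[ℝ] V →ₗ[ℝ] V} (hm : IsCrossProduct m) (hV : Module.finrank ℝ V = 7)

section

include hV

lemma exists_isBasicTriple {a b : V} (ha : ‖a‖ = 1) (hb : ‖b‖ = 1) (hab : ⟪a, b⟫ = 0) :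
    ∃ c, IsBasicTriple m a b c := by
  have : FiniteDimensional ℝ V := Module.finite_of_finrank_pos (by omega)
  obtain ⟨c, hc, h⟩ := exists_unit_orthogonal (Submodule.span ℝ (Set.range ![a, b, m a b]))
    (((finrank_range_le_card _).trans (by simp)).trans_lt (by omega : 3 < Module.finrank ℝ V))
  have h' : ∀ i, ⟪![a, b, m a b] i, c⟫ = 0 := fun i => h _ (Submodule.subset_span ⟨i, rfl⟩)
  exact ⟨c, ha, hb, hc, hab, h' 0, h' 1, h' 2⟩

include hm

lemma exists_frame {a b c : V} (h : IsBasicTriple m a b c) : ∃ u : Euc 7 ≃ₗᵢ[ℝ] V,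
    (∀ x, u x = ∑ i, x i • crossFrame m a b c i) ∧
      ∀ x y z, ⟪m (u x) (u y), u z⟫ = phi0 ![x, y, z] := by
  have ho := orthonormal_crossFrame hm h
  let B := (basisOfOrthonormalOfCardEqFinrank ho (by simp [hV])).toOrthonormalBasis (by simpa)
  have hB : ∀ x, B.repr.symm x = ∑ i, x i • crossFrame m a b c i := by
    intro x
    rw [← OrthonormalBasis.sum_repr_symm]
    simp [B]
  refine ⟨B.repr.symm, hB, fun x y z => ?_⟩
  rw [hB, hB, hB, inner_crossFrame hm h]

/-- The isometry carrying one cross frame to the other is an automorphism, because both frames turn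
`m` into the same form `phi0`. The triples occupy positions 0, 1 and 3 of the frames. -/
lemma exists_preservesCross {a b c a' b' c' : V} (h : IsBasicTriple m a b c)
    (h' : IsBasicTriple m a' b' c') :
    ∃ A : V ≃ₗᵢ[ℝ] V, PreservesCross m A ∧ A a = a' ∧ A b = b' ∧ A c = c' := by
  obtain ⟨u, hu, hu'⟩ := exists_frame hm hV h
  obtain ⟨w, hw, hw'⟩ := exists_frame hm hV h'
  have hs : ∀ i, w (u.symm (crossFrame m a b c i)) = crossFrame m a' b' c' i := by
    intro i
    have h1 : crossFrame m a b c i = u (EuclideanSpace.single i 1) := by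
      simp [hu, PiLp.single_apply]
    rw [h1, u.symm_apply_apply, hw]
    simp [PiLp.single_apply]
  refine ⟨u.symm.trans w, fun x y => ext_inner_right ℝ fun z => ?_, hs 0, hs 1, hs 3⟩
  obtain ⟨z, rfl⟩ := w.surjective z
  simp only [LinearIsometryEquiv.trans_apply]
  rw [w.inner_map_map, hw', ← hu', ← u.inner_map_map]
  simp only [LinearIsometryEquiv.apply_symm_apply]

end

lemma PreservesCross.trans {A B : V ≃ₗᵢ[ℝ] V} (hA : PreservesCross m A) (hB : PreservesCross m B) :
    PreservesCross m (A.trans B) := fun x y => by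
  simp only [LinearIsometryEquiv.trans_apply, hA x y, hB (A x) (A y)]

lemma IsBasicTriple.neg_fst {a b c : V} (h : IsBasicTriple m a b c) :
    IsBasicTriple m (-a) b c := by
  obtain ⟨ha, hb, hc, hab, hac, hbc, habc⟩ := h
  constructor <;> simp [*]

lemma IsBasicTriple.neg_snd {a b c : V} (h : IsBasicTriple m a b c) :
    IsBasicTriple m a (-b) c := by
  obtain ⟨ha, hb, hc, hab, hac, hbc, habc⟩ := h
  constructor <;> simp [*]

lemma IsBasicTriple.neg_trd {a b c : V} (h : IsBasicTriple m a b c) :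
    IsBasicTriple m a b (-c) := by
  obtain ⟨ha, hb, hc, hab, hac, hbc, habc⟩ := h
  constructor <;> simp [*]

include hm hV

/-- Such an `A` is diagonal in the cross frame, and each of the three signs occurs in exactly four
of the seven diagonal entries. -/
lemma det_eq_one_of_signs {a b c : V} (h : IsBasicTriple m a b c) {A : V ≃ₗᵢ[ℝ] V}
    (hA : PreservesCross m A) {r s t : ℝ} (hr : r ^ 2 = 1) (hs : s ^ 2 = 1) (ht : t ^ 2 = 1)
    (ha : A a = r • a) (hb : A b = s • b) (hc : A c = t • c) :
    LinearMap.det (A.toLinearEquiv : V →ₗ[ℝ] V) = 1 := by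
  let B := basisOfOrthonormalOfCardEqFinrank (orthonormal_crossFrame hm h) (by simp [hV])
  have hB : ∀ i, B i = crossFrame m a b c i := by simp [B]
  let d : Fin 7 → ℝ := ![r, s, r * s, t, r * t, s * t, r * s * t]
  have h1 : ∀ i, A (B i) = d i • B i := by
    intro i
    rw [hB]
    fin_cases i <;> simp [crossFrame, d, hA _ _, ha, hb, hc, smul_smul] <;> ring_nf
  have h2 : LinearMap.toMatrix B B (A.toLinearEquiv : V →ₗ[ℝ] V) = Matrix.diagonal d := by
    ext i j
    have h3 : (A.toLinearEquiv : V →ₗ[ℝ] V) (B j) = d j • B j := h1 j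
    rw [LinearMap.toMatrix_apply, h3, map_smul, Finsupp.smul_apply, B.repr_self,
      Matrix.diagonal_apply, Finsupp.single_apply]
    by_cases hij : i = j
    · simp [hij]
    · simp [hij, Ne.symm hij]
  rw [← LinearMap.det_toMatrix B, h2, Matrix.det_diagonal, Fin.prod_univ_seven]
  calc _ = (r ^ 2) ^ 2 * (s ^ 2) ^ 2 * (t ^ 2) ^ 2 := by simp [d]; ring
    _ = 1 := by rw [hr, hs, ht]; norm_num

/-- With determinant `-1` there is a reversed vector. Composing with a sign-changing automorphism of
determinant 1 makes that vector fixed and keeps the determinant. After two rounds the automorphism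
fixes `v` and `w`, hence their product, and reverses some `c`; orthogonality makes `v`, `w`, `c` a
basic triple, so the determinant is 1 after all. -/
lemma PreservesCross.det_eq_one {A : V ≃ₗᵢ[ℝ] V} (hA : PreservesCross m A) :
    LinearMap.det (A.toLinearEquiv : V →ₗ[ℝ] V) = 1 := by
  have : FiniteDimensional ℝ V := Module.finite_of_finrank_pos (by omega)
  by_contra hne
  have hdet : LinearMap.det (A.toLinearEquiv : V →ₗ[ℝ] V) = -1 := by
    have h1 : |LinearMap.det (A.toLinearEquiv : V →ₗ[ℝ] V)| = 1 := by
      rw [← LinearMap.normDet_eq_abs_det]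
      exact A.toLinearIsometry.normDet_eq_one
    exact (eq_or_eq_neg_of_abs_eq h1).resolve_left hne
  have hcomp : ∀ D B : V ≃ₗᵢ[ℝ] V, LinearMap.det ((D.trans B).toLinearEquiv : V →ₗ[ℝ] V) =
      LinearMap.det (B.toLinearEquiv : V →ₗ[ℝ] V) * LinearMap.det (D.toLinearEquiv : V →ₗ[ℝ] V) :=
    fun D B => LinearMap.det_comp _ _
  have hunit : ∀ v w : V, ‖v‖ = 1 → ‖w‖ = 1 → ⟪v, w⟫ = 0 → ∃ c, IsBasicTriple m v w c :=
    fun v w => exists_isBasicTriple hV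
  obtain ⟨v, hv, hAv⟩ := exists_unit_apply_eq_neg A hdet
  obtain ⟨w₀, hw₀, hvw₀⟩ := exists_unit_orthogonal (Submodule.span ℝ {v})
    ((finrank_span_le_card _).trans_lt (by simp [hV]))
  obtain ⟨c₀, h₀⟩ := hunit v w₀ hv hw₀ (hvw₀ v (Submodule.mem_span_singleton_self v))
  obtain ⟨D, hD, hDv, hDw, hDc⟩ := exists_preservesCross hm hV h₀ h₀.neg_fst
  have hD1 := det_eq_one_of_signs hm hV h₀ hD (r := -1) (s := 1) (t := 1) (by norm_num)
    (by norm_num) (by norm_num) (by simpa using hDv) (by simpa using hDw) (by simpa using hDc)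
  have hBdet := hcomp D A
  rw [hD1, hdet, mul_one] at hBdet
  have hB := hD.trans hA
  have hBv : (D.trans A) v = v := by simp [hDv, hAv]
  generalize D.trans A = B at hBdet hB hBv
  obtain ⟨w, hw, hBw⟩ := exists_unit_apply_eq_neg B hBdet
  have hvw := B.inner_eq_zero_of_apply_eq_neg hBv hBw
  obtain ⟨c₁, h₁⟩ := hunit v w hv hw hvw
  obtain ⟨E, hE, hEv, hEw, hEc⟩ := exists_preservesCross hm hV h₁ h₁.neg_snd
  have hE1 := det_eq_one_of_signs hm hV h₁ hE (r := 1) (s := -1) (t := 1) (by norm_num)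
    (by norm_num) (by norm_num) (by simpa using hEv) (by simpa using hEw) (by simpa using hEc)
  have hCdet := hcomp E B
  rw [hE1, hBdet, mul_one] at hCdet
  have hC := hE.trans hB
  have hCv : (E.trans B) v = v := by simp [hEv, hBv]
  have hCw : (E.trans B) w = w := by simp [hEw, hBw]
  generalize E.trans B = C at hCdet hC hCv hCw
  obtain ⟨c, hc, hCc⟩ := exists_unit_apply_eq_neg C hCdet
  have hC1 := det_eq_one_of_signs hm hV ⟨hv, hw, hc, hvw,
    C.inner_eq_zero_of_apply_eq_neg hCv hCc, C.inner_eq_zero_of_apply_eq_neg hCw hCc,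
    C.inner_eq_zero_of_apply_eq_neg (by rw [hC, hCv, hCw]) hCc⟩ hC (r := 1) (s := 1) (t := -1)
    (by norm_num) (by norm_num) (by norm_num) (by simpa using hCv) (by simpa using hCw)
    (by simpa using hCc)
  rw [hCdet] at hC1
  norm_num at hC1

end Transitivity

/-! ### Special subspaces for the automorphism group of a cross product. -/

section SpecialSubspaces

variable {V : Type*} [NormedAddCommGroup V] [InnerProductSpace ℝ V]
  {m : V →ₗ[ℝ] V →ₗ[ℝ] V} (hm : IsCrossProduct m) (hV : Module.finrank ℝ V = 7)
  {G : Type*} [Group G] {ρ : Representation ℝ G V}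
  (hρ : ∀ g x y, ρ g (m x y) = m (ρ g x) (ρ g y))
  (hex : ∀ A : V ≃ₗᵢ[ℝ] V, PreservesCross m A → ∃ g, ∀ x, ρ g x = A x)

/-- A subspace of dimension at most two is contained in a plane with an orthonormal basis whose
first vector spans a subspace that contains a given proper subspace. -/
lemma exists_orthonormal_pair [FiniteDimensional ℝ V] (hV2 : 2 ≤ Module.finrank ℝ V)
    {P Q : Submodule ℝ V} (hPQ : P < Q) (hQ : Module.finrank ℝ Q ≤ 2) :
    ∃ a b : V, ‖a‖ = 1 ∧ ‖b‖ = 1 ∧ ⟪a, b⟫ = 0 ∧ P ≤ Submodule.span ℝ {a} ∧ b ∈ Q ∧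
      Q ≤ Submodule.span ℝ {a, b} := by
  obtain ⟨x, hxQ, hxP⟩ := SetLike.exists_of_lt hPQ
  set y := x - P.starProjection x with hy
  have hyQ : y ∈ Q := Q.sub_mem hxQ (hPQ.le (P.starProjection_apply_mem x))
  have hy0 : y ≠ 0 := fun h => hxP (sub_eq_zero.1 h ▸ P.starProjection_apply_mem x)
  have hyP : ∀ w ∈ P, ⟪w, y⟫ = 0 := fun w hw =>
    (Submodule.mem_orthogonal P y).1 (P.sub_starProjection_mem_orthogonal x) w hw
  set b := ‖y‖⁻¹ • y with hb'
  have hb : ‖b‖ = 1 := norm_smul_inv_norm hy0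
  have hbb : ⟪b, b⟫ = (1 : ℝ) := by rw [real_inner_self_eq_norm_sq, hb, one_pow]
  have hbQ : b ∈ Q := Q.smul_mem _ hyQ
  -- Since `b` is orthogonal to `P`, `W` still contains `P`; it has dimension at most 1, and `a`
  -- will span it unless it is zero.
  set W := Q ⊓ (Submodule.span ℝ {b})ᗮ with hW
  have hWmem : ∀ w, w ∈ W ↔ w ∈ Q ∧ ⟪b, w⟫ = 0 := fun w => by
    rw [hW, Submodule.mem_inf, Submodule.mem_orthogonal_singleton_iff_inner_right]
  have hPW : P ≤ W := fun w hw => (hWmem w).2 ⟨hPQ.le hw, by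
    rw [real_inner_comm, hb', inner_smul_right, hyP w hw, mul_zero]⟩
  have hWQ : W < Q := lt_of_le_of_ne inf_le_left fun h => by
    rw [← h, hWmem, hbb] at hbQ
    exact one_ne_zero hbQ.2
  have hW1 : Module.finrank ℝ W ≤ 1 := by
    have := Submodule.finrank_lt_finrank_of_lt hWQ
    omega
  obtain ⟨a, ha, hba, hWa⟩ : ∃ a : V, ‖a‖ = 1 ∧ ⟪b, a⟫ = 0 ∧ W ≤ Submodule.span ℝ {a} := by
    by_cases hbot : W = ⊥
    · obtain ⟨a, ha, hba⟩ := exists_unit_orthogonal (Submodule.span ℝ {b})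
        ((finrank_span_le_card _).trans_lt (by simp; omega))
      exact ⟨a, ha, hba b (Submodule.mem_span_singleton_self b), hbot ▸ bot_le⟩
    · obtain ⟨z, hz, hz0⟩ := Submodule.exists_mem_ne_zero_of_ne_bot hbot
      have hzW : ‖z‖⁻¹ • z ∈ W := W.smul_mem _ hz
      have hz1 : ‖‖z‖⁻¹ • z‖ = 1 := norm_smul_inv_norm hz0
      refine ⟨‖z‖⁻¹ • z, hz1, ((hWmem _).1 hzW).2, ?_⟩
      refine (Submodule.eq_of_le_of_finrank_le ?_ ?_).ge
      · exact (Submodule.span_singleton_le_iff_mem _ _).2 hzW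
      · rwa [finrank_span_singleton (norm_ne_zero_iff.1 (by rw [hz1]; exact one_ne_zero))]
  refine ⟨a, b, ha, hb, by rw [real_inner_comm, hba], hPW.trans hWa, hbQ, fun w hw => ?_⟩
  have h1 : w - ⟪b, w⟫ • b ∈ W := (hWmem _).2 ⟨Q.sub_mem hw (Q.smul_mem _ hbQ), by
    rw [inner_sub_right, inner_smul_right, hbb, mul_one, sub_self]⟩
  obtain ⟨t, ht⟩ := Submodule.mem_span_singleton.1 (hWa h1)
  exact Submodule.mem_span_pair.2 ⟨t, ⟪b, w⟫, by rw [ht, sub_add_cancel]⟩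

include hm hV hex

/-- A special subspace has dimension at least three. -/
lemma three_le_finrank_of_isSpecialSubspace {k : SpecialNotion} {Q : Submodule ℝ V}
    (hQ : IsSpecialSubspace ρ Q k) : 3 ≤ Module.finrank ℝ Q := by
  have : FiniteDimensional ℝ V := Module.finite_of_finrank_pos (by omega)
  by_contra! hlt
  have hdet : ∃ P < Q, RestrictionDetermines ρ P Q ∨ ImageDetermines ρ P Q := by
    cases k with
    | restriction => obtain ⟨P, h1, h2, -⟩ := hQ; exact ⟨P, h1, .inl h2⟩
    | image => obtain ⟨P, h1, h2, -⟩ := hQ; exact ⟨P, h1, .inr h2⟩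
  obtain ⟨P, hPQ, hdet⟩ := hdet
  obtain ⟨a, b, ha, hb, hab, hPa, hbQ, hQab⟩ :=
    exists_orthonormal_pair (by omega) hPQ (by omega : Module.finrank ℝ Q ≤ 2)
  obtain ⟨c, h⟩ := exists_isBasicTriple (m := m) hV ha hb hab
  have h' : IsBasicTriple m a c b := by
    obtain ⟨-, -, hc, -, hac, hbc, habc⟩ := h
    refine ⟨ha, hc, hb, hac, hab, by rw [real_inner_comm, hbc], ?_⟩
    rw [hm.cyclic, hm.anti, inner_neg_left, ← hm.cyclic, habc, neg_zero]
  -- This automorphism is the identity on `P` but moves `b` out of `Q`, which contradicts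
  -- determinacy in either sense.
  obtain ⟨A, hA, hAa, hAb, -⟩ := exists_preservesCross hm hV h h'
  obtain ⟨g, hg⟩ := hex A hA
  have hfix : ∀ x ∈ P, ρ g x = ρ (1 : G) x := by
    intro x hx
    obtain ⟨t, rfl⟩ := Submodule.mem_span_singleton.1 (hPa hx)
    rw [hg, map_smul, hAa, map_one, Module.End.one_apply]
  have hcQ : c ∉ Q := by
    intro hc
    obtain ⟨s, t, hst⟩ := Submodule.mem_span_pair.1 (hQab hc)
    have h1 : ⟪c, c⟫ = (1 : ℝ) := by rw [real_inner_self_eq_norm_sq, h.norm_trd, one_pow]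
    nth_rw 1 [← hst] at h1
    rw [inner_add_left, inner_smul_left, inner_smul_left, h.inner_fst_trd, h.inner_snd_trd] at h1
    simp at h1
  have hgb : ρ g b = c := by rw [hg, hAb]
  rcases hdet with hdet | hdet
  · have h1 := hdet g 1 hfix b hbQ
    rw [hgb, map_one, Module.End.one_apply] at h1
    exact hcQ (h1 ▸ hbQ)
  · have h1 := hdet g 1 (by
      ext y
      simp only [Submodule.mem_map]
      exact exists_congr fun x => and_congr_right fun hx => by rw [hfix x hx])
    rw [map_one] at h1
    apply hcQ
    have h2 : c ∈ Q.map (ρ g) := ⟨b, hbQ, hgb⟩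
    rw [h1] at h2
    obtain ⟨y, hy, rfl⟩ := h2
    exact hy

include hρ

/-- The generating subspace is `span {a, b}`: an automorphism commutes with the product, so its
effect on `a` and `b` decides its effect on `m a b`. Minimality is the lower bound of three. -/
lemma isMinimalSpecialSubspace_span (k : SpecialNotion) {a b : V} (ha : ‖a‖ = 1) (hb : ‖b‖ = 1)
    (hab : ⟪a, b⟫ = 0) :
    IsMinimalSpecialSubspace k ρ (Submodule.span ℝ {a, b, m a b}) := by
  have : FiniteDimensional ℝ V := Module.finite_of_finrank_pos (by omega)
  have hd : ‖m a b‖ = 1 := hm.norm_eq_one ha hb hab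
  set d := m a b with hd'
  have hda : ⟪d, a⟫ = 0 := hm.inner_left a b
  have hdb : ⟪d, b⟫ = 0 := hm.inner_right a b
  set P := Submodule.span ℝ {a, b, d} with hP
  set P' := Submodule.span ℝ {a, b} with hP'
  have haP : a ∈ P := Submodule.subset_span (by simp)
  have hbP : b ∈ P := Submodule.subset_span (by simp)
  have hdP : d ∈ P := Submodule.subset_span (by simp)
  have haP' : a ∈ P' := Submodule.subset_span (by simp)
  have hbP' : b ∈ P' := Submodule.subset_span (by simp)
  have hcard : Module.finrank ℝ P ≤ 3 := by
    have h1 : ({a, b, d} : Set V) = Set.range ![a, b, d] := by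
      simp only [Matrix.range_cons, Matrix.range_empty, Set.union_empty, Set.singleton_union]
    rw [hP, h1]
    exact (finrank_range_le_card _).trans (by simp)
  have hlt : P' < P := by
    refine lt_of_le_of_ne (Submodule.span_mono (by simp [Set.insert_subset_iff])) fun h => ?_
    rw [← h] at hdP
    obtain ⟨s, t, hst⟩ := Submodule.mem_span_pair.1 hdP
    have h1 : ⟪d, d⟫ = (1 : ℝ) := by rw [real_inner_self_eq_norm_sq, hd, one_pow]
    nth_rw 2 [← hst] at h1
    rw [inner_add_right, inner_smul_right, inner_smul_right, hda, hdb] at h1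
    simp at h1
  have hP'2 : 2 ≤ Module.finrank ℝ P' := by
    have hli : LinearIndependent ℝ ![a, b] := by
      apply Orthonormal.linearIndependent (𝕜 := ℝ)
      rw [orthonormal_iff_ite]
      intro i j
      fin_cases i <;> fin_cases j <;> simp [ha, hb, hab, real_inner_comm a b]
    have h1 := finrank_span_eq_card hli
    rw [Matrix.range_cons, Matrix.range_cons, Matrix.range_empty, Set.union_empty] at h1
    have h2 : ({a} ∪ {b} : Set V) = {a, b} := rfl
    rw [h2] at h1
    rw [hP', h1]
    simp
  -- On the plane `P'` the product is the determinant times `d`, so the image of the plane alone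
  -- determines the line of the product. This is what the image sense needs.
  have hmP : ∀ x ∈ P', ∀ y ∈ P', m x y ∈ P := by
    intro x hx y hy
    obtain ⟨s, t, rfl⟩ := Submodule.mem_span_pair.1 hx
    obtain ⟨s', t', rfl⟩ := Submodule.mem_span_pair.1 hy
    have h1 : m (s • a + t • b) (s' • a + t' • b) = (s * t' - t * s') • d := by
      simp only [map_add, map_smul, LinearMap.add_apply, LinearMap.smul_apply, hm.apply_self,
        hm.anti b a, ← hd']
      module
    rw [h1]
    exact P.smul_mem _ hdP
  have hle : ∀ g h : G, P'.map (ρ g) ≤ P'.map (ρ h) → P.map (ρ g) ≤ P.map (ρ h) := by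
    intro g h hgh
    have hsub : ∀ x ∈ P', ρ g x ∈ P'.map (ρ h) := fun x hx => hgh ⟨x, hx, rfl⟩
    rw [hP, Submodule.map_span_le, ← hP]
    have hmono : P'.map (ρ h) ≤ P.map (ρ h) := Submodule.map_mono hlt.le
    rintro x (rfl | rfl | rfl)
    · exact hmono (hsub _ haP')
    · exact hmono (hsub _ hbP')
    · obtain ⟨a', ha', hga⟩ := hsub a haP'
      obtain ⟨b', hb', hgb⟩ := hsub b hbP'
      refine ⟨m a' b', hmP a' ha' b' hb', ?_⟩
      rw [hd', hρ, hρ, hga, hgb]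
  refine ⟨?_, fun Q hQ => hcard.trans (three_le_finrank_of_isSpecialSubspace hm hV hex hQ)⟩
  cases k with
  | restriction =>
    refine ⟨P', hlt, fun g h hgh x hx => ?_, fun P'' hPP'' hdet => ?_⟩
    · have hga := hgh a haP'
      have hgb := hgh b hbP'
      have h1 : P ≤ LinearMap.eqLocus (ρ g) (ρ h) := by
        rw [hP, Submodule.span_le]
        rintro x (rfl | rfl | rfl)
        · exact hga
        · exact hgb
        · change ρ g d = ρ h d
          rw [hd', hρ, hρ, hga, hgb]
      exact h1 hx
    · by_contra hne
      have hnle : ¬ P'' ≤ P := fun h => hne (le_antisymm h hPP'')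
      obtain ⟨x, hx, hxP⟩ := SetLike.not_le_iff_exists.1 hnle
      set y := x - P.starProjection x with hy
      have hyP'' : y ∈ P'' := P''.sub_mem hx (hPP'' (P.starProjection_apply_mem x))
      have hy0 : y ≠ 0 := by
        intro h
        exact hxP (sub_eq_zero.1 h ▸ P.starProjection_apply_mem x)
      have hyP : ∀ w ∈ P, ⟪w, y⟫ = 0 := fun w hw =>
        (Submodule.mem_orthogonal P y).1 (P.sub_starProjection_mem_orthogonal x) w hw
      have hc : IsBasicTriple m a b (‖y‖⁻¹ • y) := by
        refine ⟨ha, hb, norm_smul_inv_norm hy0, hab, ?_, ?_, ?_⟩ <;>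
          rw [inner_smul_right, hyP _ (by assumption), mul_zero]
      -- Anything beyond `P` contributes a unit vector orthogonal to it, which an automorphism
      -- fixing `a` and `b` can reverse.
      obtain ⟨A, hA, hAa, hAb, hAc⟩ := exists_preservesCross hm hV hc hc.neg_trd
      obtain ⟨g, hg⟩ := hex A hA
      have hfix : ∀ x ∈ P', ρ g x = ρ (1 : G) x := by
        intro x hx
        obtain ⟨s, t, rfl⟩ := Submodule.mem_span_pair.1 hx
        rw [hg, map_add, map_smul, map_smul, hAa, hAb, map_one, Module.End.one_apply]
      have h1 := hdet g 1 hfix (‖y‖⁻¹ • y) (P''.smul_mem _ hyP'')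
      rw [hg, hAc, map_one, Module.End.one_apply, neg_eq_iff_add_eq_zero, ← two_smul ℝ,
        smul_eq_zero_iff_right two_ne_zero] at h1
      have h2 := hc.norm_trd
      rw [h1, norm_zero] at h2
      exact zero_ne_one h2
  | image =>
    -- In the image sense maximality is a dimension count: `P'` has dimension at least 2 and `P` at
    -- most 3.
    refine ⟨P', hlt, fun g h hgh => le_antisymm (hle g h hgh.le) (hle h g hgh.ge),
      fun P'' h1 h2 _ => Submodule.eq_of_le_of_finrank_le h2 ?_⟩
    have h3 := Submodule.finrank_lt_finrank_of_lt h1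
    omega

lemma isMinimalSpecialSubspace_span_of_orthogonal (k : SpecialNotion) {x y : V} (hx : x ≠ 0)
    (hy : y ≠ 0) (hxy : ⟪x, y⟫ = 0) :
    IsMinimalSpecialSubspace k ρ (Submodule.span ℝ {x, y, m x y}) := by
  have hx' := norm_ne_zero_iff.2 hx
  have hy' := norm_ne_zero_iff.2 hy
  set a := ‖x‖⁻¹ • x with ha
  set b := ‖y‖⁻¹ • y with hb
  have hspan : Submodule.span ℝ {x, y, m x y} = Submodule.span ℝ {a, b, m a b} := by
    have hxa : x = ‖x‖ • a := by rw [ha, smul_inv_smul₀ hx']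
    have hyb : y = ‖y‖ • b := by rw [hb, smul_inv_smul₀ hy']
    have hxy : m x y = (‖x‖ * ‖y‖) • m a b := by
      have h : m (‖x‖ • a) (‖y‖ • b) = (‖x‖ * ‖y‖) • m a b := by
        rw [map_smul, LinearMap.map_smul₂, smul_smul, mul_comm]
      rwa [← hxa, ← hyb] at h
    have hab : m a b = (‖x‖ * ‖y‖)⁻¹ • m x y := by
      rw [hxy, inv_smul_smul₀ (mul_ne_zero hx' hy')]
    apply le_antisymm <;> rw [Submodule.span_le, Set.insert_subset_iff, Set.insert_subset_iff,
      Set.singleton_subset_iff]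
    · have h1 : ‖x‖ • a ∈ Submodule.span ℝ {a, b, m a b} :=
        Submodule.smul_mem _ _ (Submodule.subset_span (by simp))
      have h2 : ‖y‖ • b ∈ Submodule.span ℝ {a, b, m a b} :=
        Submodule.smul_mem _ _ (Submodule.subset_span (by simp))
      rw [← hxa] at h1
      rw [← hyb] at h2
      refine ⟨h1, h2, ?_⟩
      rw [hxy]
      exact Submodule.smul_mem _ _ (Submodule.subset_span (by simp))
    · rw [hab]
      refine ⟨Submodule.smul_mem _ _ ?_, Submodule.smul_mem _ _ ?_, Submodule.smul_mem _ _ ?_⟩ <;>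
        exact Submodule.subset_span (by simp)
  rw [hspan]
  exact isMinimalSpecialSubspace_span hm hV hρ hex k (norm_smul_inv_norm hx)
    (norm_smul_inv_norm hy) (by rw [ha, hb, inner_smul_left, inner_smul_right, hxy]; simp)

end SpecialSubspaces

/-! ### The cross product on the 7-sphere -/

lemma AlternatingMap.four_curryLeft {E : Type*} [AddCommGroup E] [Module ℝ E]
    (f : E [⋀^Fin 4]→ₗ[ℝ] ℝ) (x X Y Z : E) :
    f ![x, X, Y, Z] = ((f.curryLeft x).curryLeft X).curryLeft Y ![Z] := rfl

lemma phi_eq_curryLeft (x X Y Z : Euc 8) :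
    phi x X Y Z = ((theta.curryLeft x).curryLeft X).curryLeft Y ![Z] :=
  theta.four_curryLeft x X Y Z

lemma inner_Phi (x X Y Z : Euc 8) : ⟪Phi x X Y, Z⟫ = phi x X Y Z := by
  rw [phi_apply, PiLp.inner_apply]
  exact Finset.sum_congr rfl fun i _ => by simp [mul_comm]

lemma AlternatingMap.four_swap {E : Type*} [AddCommGroup E] [Module ℝ E]
    (f : E [⋀^Fin 4]→ₗ[ℝ] ℝ) (x X Y Z : E) : f ![X, x, Y, Z] = -f ![x, X, Y, Z] ∧
      f ![x, Y, X, Z] = -f ![x, X, Y, Z] ∧ f ![x, X, Z, Y] = -f ![x, X, Y, Z] := by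
  have h1 := f.map_swap ![x, X, Y, Z] (i := 0) (j := 1) (by decide)
  have h2 := f.map_swap ![x, X, Y, Z] (i := 1) (j := 2) (by decide)
  have h3 := f.map_swap ![x, X, Y, Z] (i := 2) (j := 3) (by decide)
  rw [show ![x, X, Y, Z] ∘ Equiv.swap (0 : Fin 4) 1 = ![X, x, Y, Z] by
    funext i; fin_cases i <;> rfl] at h1
  rw [show ![x, X, Y, Z] ∘ Equiv.swap (1 : Fin 4) 2 = ![x, Y, X, Z] by
    funext i; fin_cases i <;> rfl] at h2
  rw [show ![x, X, Y, Z] ∘ Equiv.swap (2 : Fin 4) 3 = ![x, X, Z, Y] by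
    funext i; fin_cases i <;> rfl] at h3
  exact ⟨h1, h2, h3⟩

lemma phi_swap_left (x X Y Z : Euc 8) : phi X x Y Z = -phi x X Y Z :=
  (theta.four_swap x X Y Z).1

lemma phi_swap_mid (x X Y Z : Euc 8) : phi x Y X Z = -phi x X Y Z :=
  (theta.four_swap x X Y Z).2.1

lemma phi_swap_right (x X Y Z : Euc 8) : phi x X Z Y = -phi x X Y Z :=
  (theta.four_swap x X Y Z).2.2

lemma phi_self_left (x Y Z : Euc 8) : phi x x Y Z = 0 := by
  linarith [phi_swap_left x x Y Z]

lemma phi_self_mid (x X Z : Euc 8) : phi x X X Z = 0 := by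
  linarith [phi_swap_mid x X X Z]

lemma phi_self_right (x X Y : Euc 8) : phi x X Y Y = 0 := by
  linarith [phi_swap_right x X Y Y]

lemma phi_self_first_third (x X Z : Euc 8) : phi x X x Z = 0 := by
  rw [phi_swap_mid, phi_self_left, neg_zero]

lemma phi_self_first_fourth (x X Y : Euc 8) : phi x X Y x = 0 := by
  rw [phi_swap_right, phi_self_first_third, neg_zero]

lemma phi_self_second_fourth (x X Y : Euc 8) : phi x X Y X = 0 := by
  rw [phi_swap_right, phi_self_mid, neg_zero]

lemma Phi_swap (x X Y : Euc 8) : Phi x Y X = -Phi x X Y :=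
  ext_inner_right ℝ fun Z => by rw [inner_neg_left, inner_Phi, inner_Phi, phi_swap_mid]

lemma Phi_self_left (x Y : Euc 8) : Phi x x Y = 0 :=
  ext_inner_right ℝ fun Z => by rw [inner_Phi, phi_self_left, inner_zero_left]

lemma Phi_self_first_third (x X : Euc 8) : Phi x X x = 0 :=
  ext_inner_right ℝ fun Z => by rw [inner_Phi, phi_self_first_third, inner_zero_left]

lemma Phi_add_fst (x X Y x' : Euc 8) : Phi (x + x') X Y = Phi x X Y + Phi x' X Y :=
  ext_inner_right ℝ fun Z => by simp [inner_add_left, inner_Phi, phi_eq_curryLeft]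

lemma Phi_smul_fst (r : ℝ) (x X Y : Euc 8) : Phi (r • x) X Y = r • Phi x X Y :=
  ext_inner_right ℝ fun Z => by simp [inner_smul_left, inner_Phi, phi_eq_curryLeft]

lemma Phi_add_snd (x X Y X' : Euc 8) : Phi x (X + X') Y = Phi x X Y + Phi x X' Y :=
  ext_inner_right ℝ fun Z => by simp [inner_add_left, inner_Phi, phi_eq_curryLeft]

lemma Phi_smul_snd (r : ℝ) (x X Y : Euc 8) : Phi x (r • X) Y = r • Phi x X Y :=
  ext_inner_right ℝ fun Z => by simp [inner_smul_left, inner_Phi, phi_eq_curryLeft]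

lemma Phi_add_trd (x X Y Y' : Euc 8) : Phi x X (Y + Y') = Phi x X Y + Phi x X Y' :=
  ext_inner_right ℝ fun Z => by simp [inner_add_left, inner_Phi, phi_eq_curryLeft]

lemma Phi_smul_trd (r : ℝ) (x X Y : Euc 8) : Phi x X (r • Y) = r • Phi x X Y :=
  ext_inner_right ℝ fun Z => by simp [inner_smul_left, inner_Phi, phi_eq_curryLeft]

/-- `Phi x X` as a continuous linear map. -/
noncomputable def PhiSnd (x X : Euc 8) : Euc 8 →L[ℝ] Euc 8 :=
  LinearMap.toContinuousLinearMap
    { toFun := Phi x X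
      map_add' := Phi_add_trd x X
      map_smul' r := Phi_smul_trd r x X }

lemma PhiSnd_apply (x X Y : Euc 8) : PhiSnd x X Y = Phi x X Y := rfl

/-- `Phi x` as a continuous bilinear map. -/
noncomputable def PhiFst (x : Euc 8) : Euc 8 →L[ℝ] Euc 8 →L[ℝ] Euc 8 :=
  LinearMap.toContinuousLinearMap
    { toFun := PhiSnd x
      map_add' X X' := ContinuousLinearMap.ext fun Y => Phi_add_snd x X Y X'
      map_smul' r X := ContinuousLinearMap.ext (Phi_smul_snd r x X) }

lemma PhiFst_apply (x X : Euc 8) : PhiFst x X = PhiSnd x X := rfl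

/-- `Phi` as a continuous trilinear map. -/
noncomputable def PhiL : Euc 8 →L[ℝ] Euc 8 →L[ℝ] Euc 8 →L[ℝ] Euc 8 :=
  LinearMap.toContinuousLinearMap
    { toFun := PhiFst
      map_add' x x' := by
        ext1 X
        ext1 Y
        rw [add_apply, add_apply]
        simp only [PhiFst_apply, PhiSnd_apply, Phi_add_fst]
      map_smul' r x := by
        ext1 X
        ext1 Y
        rw [RingHom.id_apply, smul_apply, smul_apply]
        simp only [PhiFst_apply, PhiSnd_apply, Phi_smul_fst] }

lemma PhiL_apply (x X Y : Euc 8) : PhiL x X Y = Phi x X Y := rfl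

lemma Phi_mem_Tan (p : Sph 7) (X Y : Euc 8) : Phi p X Y ∈ Tan p := by
  rw [mem_Tan, real_inner_comm, inner_Phi, phi_self_first_fourth]

/-- The cross product on a tangent space of the sphere. -/
noncomputable def crossTan (p : Sph 7) : Tan p →ₗ[ℝ] Tan p →ₗ[ℝ] Tan p :=
  LinearMap.mk₂ ℝ (fun X Y => ⟨Phi p X Y, Phi_mem_Tan p X Y⟩)
    (fun X X' Y => Subtype.ext (Phi_add_snd p X Y X'))
    (fun r X Y => Subtype.ext (Phi_smul_snd r p X Y))
    (fun X Y Y' => Subtype.ext (Phi_add_trd p X Y Y'))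
    (fun r X Y => Subtype.ext (Phi_smul_trd r p X Y))

lemma coe_crossTan (p : Sph 7) (X Y : Tan p) : (crossTan p X Y : Euc 8) = Phi p X Y := rfl

lemma inner_crossTan (p : Sph 7) (X Y Z : Tan p) : ⟪crossTan p X Y, Z⟫ = phi p X Y Z := by
  rw [← inner_Phi]
  rfl

lemma norm_sq_Phi_of_tangent (p : Sph 7) {X Y : Euc 8} (hX : X ∈ Tan p) (hY : Y ∈ Tan p) :
    ‖Phi p X Y‖ ^ 2 = ‖X‖ ^ 2 * ‖Y‖ ^ 2 - ⟪X, Y⟫ ^ 2 := by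
  have hp : ‖(p : Euc 8)‖ = 1 := norm_eq_of_mem_sphere p
  rw [norm_sq_Phi, mem_Tan.1 hX, mem_Tan.1 hY, hp]
  ring

lemma isCrossProduct_crossTan (p : Sph 7) : IsCrossProduct (crossTan p) where
  anti X Y := Subtype.ext (Phi_swap _ _ _)
  cyclic X Y Z := by 
    rw [inner_crossTan, inner_crossTan]
    linarith [phi_swap_mid p X Y Z, phi_swap_right p Y X Z]
  norm_sq X Y := norm_sq_Phi_of_tangent p X.2 Y.2

lemma finrank_Tan {n : ℕ} (p : Sph n) : Module.finrank ℝ (Tan p) = n := by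
  have : Fact (Module.finrank ℝ (Euc (n + 1)) = n + 1) := ⟨by simp⟩
  exact Submodule.finrank_orthogonal_span_singleton (ne_zero_of_mem_unit_sphere p)

/-! ### The cross product is nearly parallel -/

lemma fderiv_Phi {X Y : Euc 8 → Euc 8} (hX : ContDiff ℝ ∞ X) (hY : ContDiff ℝ ∞ Y)
    (p v : Euc 8) :
    DifferentiableAt ℝ (fun y => Phi y (X y) (Y y)) p ∧
    fderiv ℝ (fun y => Phi y (X y) (Y y)) p v =
      Phi v (X p) (Y p) + Phi p (fderiv ℝ X p v) (Y p) + Phi p (X p) (fderiv ℝ Y p v) := by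
  have hXd := (hX.differentiable (by simp) p).hasFDerivAt
  have hYd := (hY.differentiable (by simp) p).hasFDerivAt
  have h := ((PhiL.hasFDerivAt (x := p)).clm_apply hXd).clm_apply hYd
  refine ⟨h.differentiableAt, ?_⟩
  have h2 := h.fderiv
  simp only [PhiL_apply] at h2
  rw [h2]
  simp [PhiL_apply]
  abel

lemma Phi_sub_left (x X X' Y : Euc 8) : Phi x (X - X') Y = Phi x X Y - Phi x X' Y := by
  simp [← PhiL_apply]

lemma Phi_sub_right (x X Y Y' : Euc 8) : Phi x X (Y - Y') = Phi x X Y - Phi x X Y' := by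
  simp [← PhiL_apply]

/-- Every term by which the ambient derivative could differ from the Levi-Civita one repeats an
argument of the alternating form: `X` in the base point term, `p` in the normal ones. -/
lemma fderiv_Phi_self {X Y : Euc 8 → Euc 8} (hX : IsTangentField (n := 7) X)
    (hY : IsTangentField (n := 7) Y) (p : Sph 7) :
    fderiv ℝ (fun y => Phi y (X y) (Y y)) p (X p) =
      Phi p (sphereConn X X p) (Y p) + Phi p (X p) (sphereConn X Y p) := by
  rw [(fderiv_Phi hX.smooth hY.smooth p (X p)).2, sphereConn_gauss hX hX, sphereConn_gauss hX hY,
    Phi_self_left, Phi_sub_left, Phi_sub_right, Phi_smul_snd, Phi_smul_trd, Phi_self_left,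
    Phi_self_first_third]
  simp

lemma covCross_self {X Y : Euc 8 → Euc 8} (hX : IsTangentField (n := 7) X)
    (hY : IsTangentField (n := 7) Y) (p : Sph 7) : covCross X X Y p = 0 := by
  -- The ambient derivative is already tangent, so the projection does nothing.
  rw [covCross, sphereConn, fderiv_Phi_self hX hY, Submodule.starProjection_eq_self_iff.2
    ((Tan p).add_mem (Phi_mem_Tan p _ _) (Phi_mem_Tan p _ _))]
  abel

lemma covPhi_self {X Y Z : Euc 8 → Euc 8} (hX : IsTangentField (n := 7) X)
    (hY : IsTangentField (n := 7) Y) (hZ : IsTangentField (n := 7) Z) (p : Sph 7) :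
    covPhi X X Y Z p = 0 := by
  simp only [covPhi, ← inner_Phi]
  rw [fderiv_inner_apply ℝ (fderiv_Phi hX.smooth hY.smooth p 0).1
    (hZ.smooth.differentiable (by simp) _), fderiv_Phi_self hX hY, sphereConn_gauss hX hZ,
    inner_sub_right, inner_smul_right, inner_Phi _ _ _ (p : Euc 8), phi_self_first_fourth,
    inner_add_left]
  ring

/-! ### The reduction of the structure group to `G₂` -/

lemma mem_G2Frames {p : Sph 7} {u : OFrame p} : u ∈ G2Frames p ↔
    ∀ a b c, ⟪crossTan p (u a) (u b), u c⟫ = phi0 ![a, b, c] := by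
  simp only [G2Frames, Set.mem_ofPred_eq, inner_crossTan]

section Frames

variable {p : Sph 7} {u : OFrame p} (hu : u ∈ G2Frames p)
include hu

lemma preservesCross_of_phi0 {g : Euc 7 ≃ₗᵢ[ℝ] Euc 7}
    (hg : ∀ x y z, phi0 ![g x, g y, g z] = phi0 ![x, y, z]) :
    PreservesCross (crossTan p) ((u.symm.trans g).trans u) := by
  rw [mem_G2Frames] at hu
  intro x y
  refine ext_inner_right ℝ fun z => ?_
  obtain ⟨x, rfl⟩ := u.surjective x
  obtain ⟨y, rfl⟩ := u.surjective y
  obtain ⟨z, rfl⟩ := ((u.symm.trans g).trans u).surjective z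
  rw [LinearIsometryEquiv.inner_map_map]
  obtain ⟨z, rfl⟩ := u.surjective z
  simp only [LinearIsometryEquiv.trans_apply, LinearIsometryEquiv.symm_apply_apply]
  rw [hu, hu, hg]

/-- The determinant condition in `G2` is automatic: conjugation by the frame turns `g` into an
automorphism of the cross product and keeps the determinant. -/
lemma mem_G2_of_phi0 {g : Euc 7 ≃ₗᵢ[ℝ] Euc 7}
    (hg : ∀ x y z, phi0 ![g x, g y, g z] = phi0 ![x, y, z]) : g ∈ G2 := by
  refine ⟨?_, hg⟩
  have h := (preservesCross_of_phi0 hu hg).det_eq_one (isCrossProduct_crossTan p) (finrank_Tan p)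
  rw [← h]
  exact (LinearMap.det_conj (g.toLinearEquiv : Euc 7 →ₗ[ℝ] Euc 7) u.toLinearEquiv).symm

lemma frameRep_crossTan (g : G2) (x y : Tan p) :
    frameRep G2 u g (crossTan p x y) = crossTan p (frameRep G2 u g x) (frameRep G2 u g y) :=
  preservesCross_of_phi0 hu g.2.2 x y

lemma exists_frameRep_eq (A : Tan p ≃ₗᵢ[ℝ] Tan p) (hA : PreservesCross (crossTan p) A) :
    ∃ g, ∀ x, frameRep G2 u g x = A x := by
  refine ⟨⟨(u.trans A).trans u.symm, mem_G2_of_phi0 hu fun x y z => ?_⟩, fun x => ?_⟩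
  · rw [mem_G2Frames] at hu
    rw [← hu, ← hu]
    simp only [LinearIsometryEquiv.trans_apply, LinearIsometryEquiv.apply_symm_apply]
    rw [← hA, LinearIsometryEquiv.inner_map_map]
  · change u (u.symm (A (u (u.symm x)))) = A x
    simp

lemma mem_G2Frames_iff (v : OFrame p) : v ∈ G2Frames p ↔ ∃ g ∈ G2, ∀ a, v a = u (g a) := by
  constructor
  · intro hv
    refine ⟨v.trans u.symm, mem_G2_of_phi0 hu fun x y z => ?_, fun a => by simp⟩
    rw [mem_G2Frames] at hu hv
    rw [← hu, ← hv]
    simp only [LinearIsometryEquiv.trans_apply, LinearIsometryEquiv.apply_symm_apply]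
  · rintro ⟨g, hg, h⟩
    rw [mem_G2Frames] at hu ⊢
    intro a b c
    rw [h, h, h, hu, hg.2]

end Frames

/-! ### Smooth local frames adapted to the cross product. -/

lemma exists_contDiffOn_normalize {E F : Type*} [NormedAddCommGroup E] [NormedSpace ℝ E]
    [NormedAddCommGroup F] [InnerProductSpace ℝ F] {f : E → F} {U : Set E} (hU : IsOpen U)
    (hf : ContDiffOn ℝ ∞ f U) {p : E} (hp : p ∈ U) (h0 : f p ≠ 0) :
    ∃ U' ⊆ U, IsOpen U' ∧ p ∈ U' ∧ (∀ q ∈ U', f q ≠ 0) ∧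
      ContDiffOn ℝ ∞ (fun q => ‖f q‖⁻¹ • f q) U' := by
  have h1 : ∀ q ∈ U ∩ f ⁻¹' {0}ᶜ, f q ≠ 0 := fun q hq => hq.2
  have hf' := hf.mono (Set.inter_subset_left (t := f ⁻¹' {0}ᶜ))
  exact ⟨U ∩ f ⁻¹' {0}ᶜ, Set.inter_subset_left,
    hf.continuousOn.isOpen_inter_preimage hU isOpen_compl_singleton, ⟨hp, h0⟩, h1,
    ((hf'.norm ℝ h1).inv fun q hq => norm_ne_zero_iff.2 (h1 q hq)).smul hf'⟩

lemma contDiffOn_Phi {E : Type*} [NormedAddCommGroup E] [NormedSpace ℝ E] {x X Y : E → Euc 8}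
    {U : Set E} (hx : ContDiffOn ℝ ∞ x U) (hX : ContDiffOn ℝ ∞ X U) (hY : ContDiffOn ℝ ∞ Y U) :
    ContDiffOn ℝ ∞ (fun q => Phi (x q) (X q) (Y q)) U := by
  have h0 : ContDiff ℝ ∞ (fun q => PhiL q) := by fun_prop
  have h : ContDiffOn ℝ ∞ (fun q => PhiL (x q)) U := h0.comp_contDiffOn hx
  exact (h.clm_apply hX).clm_apply hY

lemma exists_orthonormal_pair_Tan (p : Sph 7) :
    ∃ a b : Tan p, ‖a‖ = 1 ∧ ‖b‖ = 1 ∧ ⟪a, b⟫ = 0 := by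
  obtain ⟨a, ha, -⟩ := exists_unit_orthogonal (⊥ : Submodule ℝ (Tan p))
    (by rw [finrank_Tan, finrank_bot]; norm_num)
  obtain ⟨b, hb, hab⟩ := exists_unit_orthogonal (Submodule.span ℝ {a})
    ((finrank_span_le_card _).trans_lt (by rw [finrank_Tan]; simp))
  exact ⟨a, b, ha, hb, hab a (Submodule.mem_span_singleton_self a)⟩

/-- Gram–Schmidt applied to a basic triple at `p`, extended by constants: the vectors are made
orthogonal in turn to `q`, `a`, `b` and `Φ_q(a, b)`. At `p` nothing changes, so all normalizations
are possible nearby. -/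
lemma exists_local_frame (p : Sph 7) : ∃ U : Set (Euc 8), IsOpen U ∧ (p : Euc 8) ∈ U ∧
    ∃ a b c : Euc 8 → Euc 8, ContDiffOn ℝ ∞ a U ∧ ContDiffOn ℝ ∞ b U ∧ ContDiffOn ℝ ∞ c U ∧
      ∀ q : Sph 7, (q : Euc 8) ∈ U → ∃ a' b' c' : Tan q, (a' : Euc 8) = a q ∧ (b' : Euc 8) = b q ∧
        (c' : Euc 8) = c q ∧ IsBasicTriple (crossTan q) a' b' c' := by
  obtain ⟨a₀, b₀, ha₀, hb₀, hab₀⟩ := exists_orthonormal_pair_Tan p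
  obtain ⟨c₀, h₀⟩ := exists_isBasicTriple (m := crossTan p) (finrank_Tan p) ha₀ hb₀ hab₀
  have hne : ∀ {v : Tan p}, ‖v‖ = 1 → (v : Euc 8) ≠ 0 := by
    intro v hv h
    have hv' : ‖(v : Euc 8)‖ = 1 := hv
    rw [h, norm_zero] at hv'
    exact zero_ne_one hv'
  have hT : ∀ v : Tan p, ⟪(p : Euc 8), (v : Euc 8)⟫ = 0 := fun v => mem_Tan.1 v.2
  have hN : ∀ {v : Tan p}, ‖v‖ = 1 → ‖(v : Euc 8)‖⁻¹ • (v : Euc 8) = v := by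
    intro v hv
    have hv' : ‖(v : Euc 8)‖ = 1 := hv
    rw [hv', inv_one, one_smul]
  have hid : ∀ U : Set (Euc 8), ContDiffOn ℝ ∞ (fun q : Euc 8 => q) U := fun U => contDiffOn_id
  have hc : ∀ (v : Euc 8) (U : Set (Euc 8)), ContDiffOn ℝ ∞ (fun _ => v) U :=
    fun v U => contDiffOn_const
  let f : Euc 8 → Euc 8 := fun q => a₀ - ⟪q, a₀⟫ • q
  have hfp : f p = a₀ := by simp [f, hT]
  obtain ⟨U₁, -, hU₁, hp₁, hf0, ha⟩ := exists_contDiffOn_normalize (f := f) isOpen_univ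
    ((hc _ _).sub (((hid _).inner ℝ (hc _ _)).smul (hid _))) (Set.mem_univ (p : Euc 8))
    (hfp ▸ hne ha₀)
  set a : Euc 8 → Euc 8 := fun q => ‖f q‖⁻¹ • f q with ha_def
  have hap : a p = a₀ := by simp only [ha_def, hfp, hN ha₀]
  let g : Euc 8 → Euc 8 := fun q => b₀ - ⟪q, b₀⟫ • q - ⟪a q, b₀⟫ • a q
  have hgp : g p = b₀ := by
    simp only [g, hT, hap]
    rw [← Submodule.coe_inner, hab₀]
    simp
  obtain ⟨U₂, h₂₁, hU₂, hp₂, hg0, hb⟩ := exists_contDiffOn_normalize (f := g) hU₁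
    (((hc _ _).sub (((hid _).inner ℝ (hc _ _)).smul (hid _))).sub
      ((ha.inner ℝ (hc _ _)).smul ha)) hp₁ (hgp ▸ hne hb₀)
  set b : Euc 8 → Euc 8 := fun q => ‖g q‖⁻¹ • g q with hb_def
  have hbp : b p = b₀ := by simp only [hb_def, hgp, hN hb₀]
  have hd := contDiffOn_Phi (hid _) (ha.mono h₂₁) hb
  set d : Euc 8 → Euc 8 := fun q => Phi q (a q) (b q) with hd_def
  let k : Euc 8 → Euc 8 := fun q =>
    c₀ - ⟪q, c₀⟫ • q - ⟪a q, c₀⟫ • a q - ⟪b q, c₀⟫ • b q - ⟪d q, c₀⟫ • d q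
  have hkp : k p = c₀ := by
    have h1 : d p = crossTan p a₀ b₀ := by simp only [hd_def, hap, hbp, coe_crossTan]
    simp only [k, hT, hap, hbp, h1]
    rw [← Submodule.coe_inner, ← Submodule.coe_inner, ← Submodule.coe_inner, h₀.inner_fst_trd,
      h₀.inner_snd_trd, h₀.inner_apply_trd]
    simp
  obtain ⟨U₃, h₃₂, hU₃, hp₃, hk0, hcc⟩ := exists_contDiffOn_normalize (f := k) hU₂
    (((((hc _ _).sub (((hid _).inner ℝ (hc _ _)).smul (hid _))).sub
      (((ha.mono h₂₁).inner ℝ (hc _ _)).smul (ha.mono h₂₁))).sub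
      ((hb.inner ℝ (hc _ _)).smul hb)).sub ((hd.inner ℝ (hc _ _)).smul hd)) hp₂
    (hkp ▸ hne h₀.norm_trd)
  refine ⟨U₃, hU₃, hp₃, a, b, fun q => ‖k q‖⁻¹ • k q, ha.mono (h₃₂.trans h₂₁), hb.mono h₃₂, hcc,
    fun q hq => ?_⟩
  have hqq : ⟪(q : Euc 8), q⟫ = (1 : ℝ) := by
    rw [real_inner_self_eq_norm_sq, norm_eq_of_mem_sphere, one_pow]
  have hsq : ∀ {v : Euc 8}, ‖v‖ = 1 → ⟪v, v⟫ = (1 : ℝ) := fun h => by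
    rw [real_inner_self_eq_norm_sq, h, one_pow]
  have na : ‖a q‖ = 1 := norm_smul_inv_norm (hf0 q (h₂₁ (h₃₂ hq)))
  have nb : ‖b q‖ = 1 := norm_smul_inv_norm (hg0 q (h₃₂ hq))
  have nc : ‖‖k q‖⁻¹ • k q‖ = 1 := norm_smul_inv_norm (hk0 q hq)
  have qa : ⟪(q : Euc 8), a q⟫ = 0 := by
    simp only [ha_def, f]
    rw [inner_smul_right, inner_sub_right, inner_smul_right, hqq]
    ring
  have qb : ⟪(q : Euc 8), b q⟫ = 0 := by
    simp only [hb_def, g]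
    rw [inner_smul_right, inner_sub_right, inner_sub_right, inner_smul_right, inner_smul_right, hqq,
      qa]
    ring
  have aq : ⟪a q, (q : Euc 8)⟫ = 0 := by rw [real_inner_comm, qa]
  have bq : ⟪b q, (q : Euc 8)⟫ = 0 := by rw [real_inner_comm, qb]
  have ab : ⟪a q, b q⟫ = 0 := by
    simp only [hb_def, g]
    rw [inner_smul_right, inner_sub_right, inner_sub_right, inner_smul_right, inner_smul_right, aq,
      hsq na]
    ring
  have dq : ⟪d q, (q : Euc 8)⟫ = 0 := by
    rw [real_inner_comm]
    exact mem_Tan.1 (Phi_mem_Tan q _ _)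
  have da : ⟪d q, a q⟫ = 0 := by simp only [hd_def, inner_Phi, phi_self_second_fourth]
  have db : ⟪d q, b q⟫ = 0 := by simp only [hd_def, inner_Phi, phi_self_right]
  have nd : ⟪d q, d q⟫ = (1 : ℝ) := by
    rw [real_inner_self_eq_norm_sq, hd_def, norm_sq_Phi_of_tangent q (mem_Tan.2 qa) (mem_Tan.2 qb),
      na, nb, ab]
    norm_num
  have hk : ∀ {v : Euc 8} (_ : ⟪v, k q⟫ = 0), ⟪v, ‖k q‖⁻¹ • k q⟫ = 0 := fun h => by
    rw [inner_smul_right, h, mul_zero]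
  have kexp : ∀ v : Euc 8, ⟪v, k q⟫ = ⟪v, (c₀ : Euc 8)⟫ - ⟪(q : Euc 8), c₀⟫ * ⟪v, (q : Euc 8)⟫ -
      ⟪a q, c₀⟫ * ⟪v, a q⟫ - ⟪b q, c₀⟫ * ⟪v, b q⟫ - ⟪d q, c₀⟫ * ⟪v, d q⟫ := fun v => by
    simp only [k, inner_sub_right, inner_smul_right]
  refine ⟨⟨a q, mem_Tan.2 qa⟩, ⟨b q, mem_Tan.2 qb⟩,
    ⟨‖k q‖⁻¹ • k q, mem_Tan.2 (hk ?_)⟩, rfl, rfl, rfl, na, nb, nc, ab, hk ?_, hk ?_, hk ?_⟩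
  · rw [kexp, hqq, qa, qb, real_inner_comm (d q), dq]
    ring
  · change ⟪a q, k q⟫ = 0
    rw [kexp, aq, hsq na, ab, real_inner_comm (d q), da]
    ring
  · change ⟪b q, k q⟫ = 0
    rw [kexp, bq, real_inner_comm (a q), ab, hsq nb, real_inner_comm (d q), db]
    ring
  · change ⟪d q, k q⟫ = 0
    rw [kexp, dq, da, db, nd]
    ring

lemma exists_mem_G2Frames (p : Sph 7) : ∃ u : OFrame p, u ∈ G2Frames p := by
  obtain ⟨a, b, ha, hb, hab⟩ := exists_orthonormal_pair_Tan p
  obtain ⟨c, h⟩ := exists_isBasicTriple (m := crossTan p) (finrank_Tan p) ha hb hab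
  obtain ⟨u, -, hu⟩ := exists_frame (isCrossProduct_crossTan p) (finrank_Tan p) h
  exact ⟨u, mem_G2Frames.2 hu⟩

lemma isReduction_G2Frames : IsReduction G2 G2Frames := by
  refine ⟨fun p => ?_, fun p u hu v => mem_G2Frames_iff hu v⟩
  obtain ⟨U, hU, hp, a, b, c, ha, hb, hc, h⟩ := exists_local_frame p
  have hid : ContDiffOn ℝ ∞ (fun q : Euc 8 => q) U := contDiffOn_id
  have hd := contDiffOn_Phi hid ha hb
  let f : Fin 7 → Euc 8 → Euc 8 := ![a, b, fun q => Phi q (a q) (b q), c,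
    fun q => Phi q (a q) (c q), fun q => Phi q (b q) (c q),
    fun q => Phi q (Phi q (a q) (b q)) (c q)]
  have hf : ∀ i, ContDiffOn ℝ ∞ (f i) U := by
    intro i
    fin_cases i
    · exact ha
    · exact hb
    · exact hd
    · exact hc
    · exact contDiffOn_Phi hid ha hc
    · exact contDiffOn_Phi hid hb hc
    · exact contDiffOn_Phi hid hd hc
  refine ⟨U, hU, hp, fun q => ∑ i, (EuclideanSpace.proj (𝕜 := ℝ) i).smulRight (f i q), ?_, ?_⟩
  · exact ContDiffOn.sum fun i _ => contDiffOn_const.smulRight (hf i)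
  · intro q hq
    obtain ⟨a', b', c', ha', hb', hc', ht⟩ := h q hq
    obtain ⟨u, hu, hu'⟩ := exists_frame (isCrossProduct_crossTan q) (finrank_Tan q) ht
    refine ⟨u, mem_G2Frames.2 hu', fun x => ?_⟩
    rw [hu]
    have hcoe : ∀ i, ((crossFrame (crossTan q) a' b' c' i : Tan q) : Euc 8) = f i q := by
      intro i
      fin_cases i <;> simp [crossFrame, f, coe_crossTan, ha', hb', hc']
    simp [hcoe]

/-! ### Parallel translation along the circle -/

lemma hasDerivAt_euclidean {n : ℕ} {X : ℝ → Euc n} {v : Euc n} {t : ℝ}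
    (h : ∀ i, HasDerivAt (fun t => X t i) (v i) t) : HasDerivAt X v t :=
  (PiLp.continuousLinearEquiv 2 ℝ fun _ : Fin n => ℝ).symm.toContinuousLinearMap.hasFDerivAt
    |>.comp_hasDerivAt t (hasDerivAt_pi.2 h)

/-- A tangent field is parallel when its ambient derivative is a multiple of the position vector.
The factor `w` serves both time scales: `1` for the circle as given, `2π` for the loop on `[0, 1]`.
-/
lemma isParallelAlong_of_hasDerivAt {n : ℕ} {γ : ℝ → Sph n} {X : ℝ → Euc (n + 1)} {f : ℝ → ℝ}
    (hX : ∀ t, HasDerivAt X (f t • (γ t : Euc (n + 1))) t) (hT : ∀ t, X t ∈ Tan (γ t)) (w : ℝ)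
    {a b : ℝ} (hab : a < b) :
    IsParallelAlong (fun t => γ (w * t)) a b (fun t => X (w * t)) := by
  have h : ∀ t, HasDerivAt (fun t => X (w * t)) ((w * f (w * t)) • (γ (w * t) : Euc (n + 1))) t := by
    intro t
    have h1 := (hX (w * t)).scomp t ((hasDerivAt_id t).const_mul w)
    rw [mul_one, smul_smul] at h1
    exact h1
  refine ⟨fun t _ => (h t).differentiableAt.differentiableWithinAt, fun t ht => ⟨hT _, ?_⟩⟩
  rw [(h t).hasDerivWithinAt.derivWithin (uniqueDiffOn_Icc hab t ht), map_smul,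
    Submodule.starProjection_orthogonal_val, Submodule.starProjection_eq_self_iff.2
      (Submodule.mem_span_singleton_self _), sub_self, smul_zero]

lemma IsParallelAlong.of_one_mul {n : ℕ} {γ : ℝ → Sph n} {X : ℝ → Euc (n + 1)} {a b : ℝ}
    (h : IsParallelAlong (fun t => γ (1 * t)) a b (fun t => X (1 * t))) :
    IsParallelAlong γ a b X := by
  simpa only [one_mul] using h

section Loop

variable {r : ℝ} (hr : r ∈ Set.Ioo (0 : ℝ) 1)
include hr

lemma sqrt_one_sub_sq_spec : 0 < √(1 - r ^ 2) ∧ √(1 - r ^ 2) < 1 ∧ √(1 - r ^ 2) ^ 2 = 1 - r ^ 2 := by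
  have h : 0 < 1 - r ^ 2 := by nlinarith [hr.1, hr.2]
  refine ⟨Real.sqrt_pos.2 h, ?_, Real.sq_sqrt h.le⟩
  rw [Real.sqrt_lt' one_pos]
  nlinarith [hr.1]

/-- The denominators cancel because `r² = (1 + s)(1 - s)`; the addition formulas then leave products
that are easy to differentiate. -/
lemma xField_eq (t : ℝ) : xField r t =
    !₂[-r * Real.sin t * Real.cos (√(1 - r ^ 2) * t) +
        r * √(1 - r ^ 2) * Real.cos t * Real.sin (√(1 - r ^ 2) * t),
      r * Real.cos t * Real.cos (√(1 - r ^ 2) * t) +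
        r * √(1 - r ^ 2) * Real.sin t * Real.sin (√(1 - r ^ 2) * t),
      0, -(r ^ 2 * Real.sin (√(1 - r ^ 2) * t)), 0, 0, 0, 0] := by
  obtain ⟨h0, h1, h2⟩ := sqrt_one_sub_sq_spec hr
  unfold xField
  generalize √(1 - r ^ 2) = s at h0 h1 h2 ⊢
  have hp : 1 + s ≠ 0 := by positivity
  have hm : 1 - s ≠ 0 := by linarith
  have hr2 : r ^ 2 = (1 + s) * (1 - s) := by linear_combination h2
  have e1 : r ^ 3 / (2 * (1 + s)) = r * (1 - s) / 2 := by
    rw [div_eq_div_iff (by simpa) two_ne_zero]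
    linear_combination (2 * r) * hr2
  have e2 : r ^ 3 / (2 * (1 - s)) = r * (1 + s) / 2 := by
    rw [div_eq_div_iff (by simpa) two_ne_zero]
    linear_combination (2 * r) * hr2
  simp only [mul_div_right_comm (r ^ 3), e1, e2, add_mul, sub_mul, one_mul, Real.sin_add,
    Real.sin_sub, Real.cos_add, Real.cos_sub]
  congr 2
  · ring
  · congr 1
    ring

lemma zField_eq (t : ℝ) : zField r t =
    !₂[-r ^ 3 * √(1 - r ^ 2) * Real.cos t * Real.cos (√(1 - r ^ 2) * t) -
        r ^ 3 * Real.sin t * Real.sin (√(1 - r ^ 2) * t),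
      -r ^ 3 * √(1 - r ^ 2) * Real.sin t * Real.cos (√(1 - r ^ 2) * t) +
        r ^ 3 * Real.cos t * Real.sin (√(1 - r ^ 2) * t),
      0, r ^ 4 * Real.cos (√(1 - r ^ 2) * t), r ^ 3 * √(1 - r ^ 2), 0, 0,
      r ^ 2 * (1 - r ^ 2)] := by
  obtain ⟨h0, h1, h2⟩ := sqrt_one_sub_sq_spec hr
  unfold zField
  generalize √(1 - r ^ 2) = s at h0 h1 h2 ⊢
  have hp : 1 + s ≠ 0 := by positivity
  have hm : 1 - s ≠ 0 := by linarith
  have hr2 : r ^ 2 = (1 + s) * (1 - s) := by linear_combination h2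
  have e1 : r ^ 5 / (2 * (1 + s)) = r ^ 3 * (1 - s) / 2 := by
    rw [div_eq_div_iff (by simpa) two_ne_zero]
    linear_combination (2 * r ^ 3) * hr2
  have e2 : r ^ 5 / (2 * (1 - s)) = r ^ 3 * (1 + s) / 2 := by
    rw [div_eq_div_iff (by simpa) two_ne_zero]
    linear_combination (2 * r ^ 3) * hr2
  simp only [mul_div_right_comm (r ^ 5), e1, e2, add_mul, sub_mul, one_mul, Real.sin_add,
    Real.sin_sub, Real.cos_add, Real.cos_sub]
  congr 2
  · ring
  · congr 1
    ring

lemma coe_xCurve (t : ℝ) : (xCurve r hr t : Euc 8) =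
    !₂[r * Real.cos t, r * Real.sin t, 0, √(1 - r ^ 2), 0, 0, 0, 0] := rfl

omit hr in
lemma hasDerivAt_sin_mul (s t : ℝ) :
    HasDerivAt (fun t => Real.sin (s * t)) (s * Real.cos (s * t)) t := by
  simpa [mul_comm] using ((hasDerivAt_id t).const_mul s).sin

omit hr in
lemma hasDerivAt_cos_mul (s t : ℝ) :
    HasDerivAt (fun t => Real.cos (s * t)) (-(s * Real.sin (s * t))) t := by
  simpa [mul_comm] using ((hasDerivAt_id t).const_mul s).cos

lemma hasDerivAt_xField (t : ℝ) : HasDerivAt (xField r)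
    ((-(r ^ 2 * Real.cos (√(1 - r ^ 2) * t))) • (xCurve r hr t : Euc 8)) t := by
  rw [show xField r = _ from funext (xField_eq hr)]
  obtain ⟨-, -, h2⟩ := sqrt_one_sub_sq_spec hr
  simp only [coe_xCurve]
  generalize √(1 - r ^ 2) = s at h2 ⊢
  have hS := hasDerivAt_sin_mul s t
  have hC := hasDerivAt_cos_mul s t
  have hS1 := Real.hasDerivAt_sin t
  have hC1 := Real.hasDerivAt_cos t
  refine hasDerivAt_euclidean fun i => ?_
  fin_cases i
  · refine (((hS1.const_mul (-r)).mul hC).add ((hC1.const_mul (r * s)).mul hS)).congr_deriv ?_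
    simp
    linear_combination r * Real.cos t * Real.cos (s * t) * h2
  · refine (((hC1.const_mul r).mul hC).add ((hS1.const_mul (r * s)).mul hS)).congr_deriv ?_
    simp
    linear_combination r * Real.sin t * Real.cos (s * t) * h2
  · simpa using hasDerivAt_const t (0 : ℝ)
  · refine (hS.const_mul (r ^ 2)).neg.congr_deriv ?_
    simp
    ring
  all_goals simpa using hasDerivAt_const t (0 : ℝ)

lemma hasDerivAt_zField (t : ℝ) : HasDerivAt (zField r)
    ((-(r ^ 4 * Real.sin (√(1 - r ^ 2) * t))) • (xCurve r hr t : Euc 8)) t := by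
  rw [show zField r = _ from funext (zField_eq hr)]
  obtain ⟨-, -, h2⟩ := sqrt_one_sub_sq_spec hr
  simp only [coe_xCurve]
  generalize √(1 - r ^ 2) = s at h2 ⊢
  have hS := hasDerivAt_sin_mul s t
  have hC := hasDerivAt_cos_mul s t
  have hS1 := Real.hasDerivAt_sin t
  have hC1 := Real.hasDerivAt_cos t
  refine hasDerivAt_euclidean fun i => ?_
  fin_cases i
  · refine (((hC1.const_mul (-r ^ 3 * s)).mul hC).sub
      ((hS1.const_mul (r ^ 3)).mul hS)).congr_deriv ?_
    simp
    linear_combination r ^ 3 * Real.cos t * Real.sin (s * t) * h2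
  · refine (((hS1.const_mul (-r ^ 3 * s)).mul hC).add
      ((hC1.const_mul (r ^ 3)).mul hS)).congr_deriv ?_
    simp
    linear_combination r ^ 3 * Real.sin t * Real.sin (s * t) * h2
  · simpa using hasDerivAt_const t (0 : ℝ)
  · refine (hC.const_mul (r ^ 4)).congr_deriv ?_
    simp
    ring
  · simpa using hasDerivAt_const t (r ^ 3 * s)
  · simpa using hasDerivAt_const t (0 : ℝ)
  · simpa using hasDerivAt_const t (0 : ℝ)
  · simpa using hasDerivAt_const t (r ^ 2 * (1 - r ^ 2))

lemma hasDerivAt_yField (t : ℝ) :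
    HasDerivAt (yField r) ((0 : ℝ) • (xCurve r hr t : Euc 8)) t := by
  rw [zero_smul]
  exact hasDerivAt_const t _

lemma hasDerivAt_xCurve (t : ℝ) : HasDerivAt (fun t => (xCurve r hr t : Euc 8))
    !₂[-(r * Real.sin t), r * Real.cos t, 0, 0, 0, 0, 0, 0] t := by
  simp only [coe_xCurve]
  refine hasDerivAt_euclidean fun i => ?_
  fin_cases i
  · simpa using (Real.hasDerivAt_cos t).const_mul r
  · simpa using (Real.hasDerivAt_sin t).const_mul r
  · simpa using hasDerivAt_const t (0 : ℝ)
  · simpa using hasDerivAt_const t (√(1 - r ^ 2))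
  all_goals simpa using hasDerivAt_const t (0 : ℝ)

lemma xField_mem_Tan (t : ℝ) : xField r t ∈ Tan (xCurve r hr t) := by
  rw [mem_Tan, xField_eq hr]
  simp [xCurve, PiLp.inner_apply, Fin.sum_univ_eight]
  linear_combination r ^ 2 * √(1 - r ^ 2) * Real.sin (√(1 - r ^ 2) * t) *
    Real.sin_sq_add_cos_sq t

lemma yField_mem_Tan (t : ℝ) : yField r t ∈ Tan (xCurve r hr t) := by
  rw [mem_Tan]
  simp [xCurve, yField, PiLp.inner_apply, Fin.sum_univ_eight]

lemma zField_mem_Tan (t : ℝ) : zField r t ∈ Tan (xCurve r hr t) := by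
  rw [mem_Tan, zField_eq hr]
  simp [xCurve, PiLp.inner_apply, Fin.sum_univ_eight]
  linear_combination -r ^ 4 * √(1 - r ^ 2) * Real.cos (√(1 - r ^ 2) * t) *
    Real.sin_sq_add_cos_sq t

lemma xField_zero : xField r 0 = !₂[0, r, 0, 0, 0, 0, 0, 0] := by
  rw [xField_eq hr]
  simp

lemma xCurve_two_pi : xCurve r hr (2 * Real.pi) = xCurve r hr 0 := by
  simp [xCurve]

lemma zField_zero : zField r 0 = Phi (xCurve r hr 0) (xField r 0) (yField r 0) := by
  obtain ⟨-, -, h2⟩ := sqrt_one_sub_sq_spec hr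
  rw [zField_eq hr, xField_zero hr]
  rw [coe_xCurve]
  unfold yField
  generalize √(1 - r ^ 2) = s at h2 ⊢
  ext i
  fin_cases i <;>
    simp [Phi, phi, theta, eForm_four_apply, PiLp.single_apply] <;>
    first | ring1 | linear_combination (-r ^ 2) * h2

lemma zField_two_pi_ne : zField r (2 * Real.pi) ≠
    Phi (xCurve r hr (2 * Real.pi)) (xField r (2 * Real.pi)) (yField r (2 * Real.pi)) := by
  obtain ⟨h0, h1, h2⟩ := sqrt_one_sub_sq_spec hr
  intro h
  -- Counting from 0, this coordinate is `r³s` on the left and `r³s cos(2πs)` on the right. Equality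
  -- would make `s` an integer strictly between 0 and 1.
  have h4 := congrArg (fun v : Euc 8 => v 4) h
  dsimp only at h4
  rw [zField_eq hr, xField_eq hr] at h4
  rw [coe_xCurve] at h4
  unfold yField at h4
  generalize √(1 - r ^ 2) = s at h0 h1 h2 h4
  simp [Phi, phi, theta, eForm_four_apply, PiLp.single_apply] at h4
  have hcos : Real.cos (s * (2 * Real.pi)) = 1 := by
    have hrs : r ^ 3 * s ≠ 0 := mul_ne_zero (pow_ne_zero 3 hr.1.ne') h0.ne'
    exact mul_left_cancel₀ hrs (by linear_combination -h4)
  obtain ⟨n, hn⟩ := (Real.cos_eq_one_iff _).1 hcos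
  have hns : (n : ℝ) = s := mul_right_cancel₀ Real.two_pi_pos.ne' hn
  rw [← hns] at h0 h1
  have h0' : 0 < n := by exact_mod_cast h0
  have h1' : n < 1 := by exact_mod_cast h1
  omega

end Loop

/-! ### The subspace spanned along the circle, and the failure of weak holonomy. -/

section LoopSpan

variable {r : ℝ} (hr : r ∈ Set.Ioo (0 : ℝ) 1)

lemma loopSpan_eq : loopSpan r hr = Submodule.span ℝ
    {(⟨xField r 0, xField_mem_Tan hr 0⟩ : Tan (xCurve r hr 0)), ⟨yField r 0, yField_mem_Tan hr 0⟩,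
      crossTan (xCurve r hr 0) ⟨xField r 0, xField_mem_Tan hr 0⟩
        ⟨yField r 0, yField_mem_Tan hr 0⟩} := by
  have h : ({xField r 0, yField r 0, zField r 0} : Set (Euc 8)) =
      (Tan (xCurve r hr 0)).subtype '' {⟨xField r 0, xField_mem_Tan hr 0⟩,
        ⟨yField r 0, yField_mem_Tan hr 0⟩, crossTan (xCurve r hr 0)
          ⟨xField r 0, xField_mem_Tan hr 0⟩ ⟨yField r 0, yField_mem_Tan hr 0⟩} := by
    rw [Set.image_insert_eq, Set.image_insert_eq, Set.image_singleton, Submodule.subtype_apply,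
      Submodule.subtype_apply, Submodule.subtype_apply, coe_crossTan, ← zField_zero hr]
  rw [loopSpan, h, ← Submodule.map_span,
    Submodule.comap_map_eq_of_injective (Submodule.subtype_injective _)]

lemma isMinimalSpecialSubspace_loopSpan (k : SpecialNotion) {u : OFrame (xCurve r hr 0)}
    (hu : u ∈ G2Frames (xCurve r hr 0)) :
    IsMinimalSpecialSubspace k (frameRep G2 u) (loopSpan r hr) := by
  rw [loopSpan_eq]
  have hr0 := hr.1.ne'
  refine isMinimalSpecialSubspace_span_of_orthogonal (isCrossProduct_crossTan _) (finrank_Tan _)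
    (frameRep_crossTan hu) (exists_frameRep_eq hu) k (fun h => ?_) (fun h => ?_) ?_
  · have h1 : xField r 0 1 = 0 := congrArg (fun v : Tan (xCurve r hr 0) => (v : Euc 8) 1) h
    rw [xField_zero hr] at h1
    exact hr0 h1
  · have h1 : yField r 0 2 = 0 := congrArg (fun v : Tan (xCurve r hr 0) => (v : Euc 8) 2) h
    exact pow_ne_zero 2 hr0 h1
  · change ⟪xField r 0, yField r 0⟫ = 0
    rw [xField_zero hr]
    simp [yField, PiLp.inner_apply, Fin.sum_univ_eight]

lemma not_isWeakHolonomyGroup (k : SpecialNotion) : ¬ IsWeakHolonomyGroup k G2 G2Frames := by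
  intro h
  -- One radius is enough, and any in `(0, 1)` would do.
  have hr : (1 / 2 : ℝ) ∈ Set.Ioo (0 : ℝ) 1 := by norm_num
  obtain ⟨u, hu⟩ := exists_mem_G2Frames (xCurve (1 / 2) hr 0)
  have hloop : IsLoopAt (xCurve (1 / 2) hr 0)
      (fun t => xCurve (1 / 2) hr (2 * Real.pi * t)) := by
    refine ⟨ContDiff.contDiffOn ?_, by rw [mul_zero],
      by rw [mul_one, xCurve_two_pi hr]⟩
    simp only [coe_xCurve]
    refine contDiff_euclidean.2 fun i => ?_
    fin_cases i <;> simp <;> fun_prop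
  obtain ⟨g, hg⟩ := h _ u hu _ hloop
  have hP := hg _ (isMinimalSpecialSubspace_loopSpan hr k hu) ?_
  · have h01 : (0 : ℝ) < 1 := zero_lt_one
    have hXP := hP _ (isParallelAlong_of_hasDerivAt (hasDerivAt_xField hr) (xField_mem_Tan hr)
      (2 * Real.pi) h01)
    have hYP := hP _ (isParallelAlong_of_hasDerivAt (f := fun _ => 0) (hasDerivAt_yField hr)
      (yField_mem_Tan hr) (2 * Real.pi) h01)
    have hZP := hP _ (isParallelAlong_of_hasDerivAt (hasDerivAt_zField hr) (zField_mem_Tan hr)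
      (2 * Real.pi) h01)
    rw [loopSpan_eq] at hXP hYP hZP
    simp only [mul_zero, mul_one] at hXP hYP hZP
    have hX := hXP _ (Submodule.subset_span (Set.mem_insert _ _)) rfl
    have hY := hYP _ (Submodule.subset_span (Set.mem_insert_of_mem _ (Set.mem_insert _ _))) rfl
    have hZ := hZP _ (Submodule.subset_span (Set.mem_insert_of_mem _ (Set.mem_insert_of_mem _
      (Set.mem_singleton _)))) (by rw [coe_crossTan, ← zField_zero hr])
    -- Since `g` respects the product, the relation `Z₀ = Φ(X₀, Y₀)` is carried to the end of the
    -- loop.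
    rw [frameRep_crossTan hu, coe_crossTan, ← hX, ← hY] at hZ
    apply zField_two_pi_ne hr
    rw [hZ, xCurve_two_pi hr]
  · rw [loopSpan_eq]
    -- The loop runs through the circle in unit time, so its initial velocity is `2π X₀`.
    refine ⟨(2 * Real.pi) • ⟨xField (1 / 2) 0, xField_mem_Tan hr 0⟩,
      Submodule.smul_mem _ _ (Submodule.subset_span (Set.mem_insert _ _)), ?_⟩
    have h1 : HasDerivAt (fun t => (xCurve (1 / 2) hr (2 * Real.pi * t) : Euc 8))
        ((2 * Real.pi) • xField (1 / 2) 0) 0 := by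
      have h2 := (hasDerivAt_xCurve hr (2 * Real.pi * 0)).scomp (0 : ℝ)
        ((hasDerivAt_id (0 : ℝ)).const_mul (2 * Real.pi))
      refine h2.congr_deriv ?_
      rw [xField_zero hr]
      simp
    exact (h1.hasDerivWithinAt.derivWithin (uniqueDiffOn_Icc zero_lt_one 0 (by simp))).symm

end LoopSpan

theorem mainTheorem3 :
    -- `Φ` is a vector cross product on the tangent spaces of `S⁷`
    (∀ p : Sph 7, ∀ X ∈ Tan p, ∀ Y ∈ Tan p,
      Phi p X Y ∈ Tan p ∧ (∀ Z ∈ Tan p, ⟪Phi p X Y, Z⟫ = phi p X Y Z) ∧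
      ⟪Phi p X Y, X⟫ = 0 ∧ ⟪Phi p X Y, Y⟫ = 0 ∧
      ‖Phi p X Y‖ ^ 2 = ‖X‖ ^ 2 * ‖Y‖ ^ 2 - ⟪X, Y⟫ ^ 2) ∧
    -- it defines a reduction of the structure group to `G₂`
    IsReduction G2 G2Frames ∧
    -- it is nearly parallel
    (∀ X Y Z : Euc 8 → Euc 8, IsTangentField (n := 7) X → IsTangentField (n := 7) Y →
      IsTangentField (n := 7) Z → ∀ p : Sph 7, covPhi X X Y Z p = 0 ∧ covCross X X Y p = 0) ∧
    -- `G₂` is not a weak holonomy group, with either notion of special subspace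
    (∀ k : SpecialNotion, ¬ IsWeakHolonomyGroup k G2 G2Frames) ∧
    -- the explicit parallel translations along a closed circle
    (∀ (r : ℝ) (hr : r ∈ Set.Ioo (0 : ℝ) 1),
      xCurve r hr (2 * Real.pi) = xCurve r hr 0 ∧
      HasDerivAt (fun t => (xCurve r hr t : Euc 8)) (xField r 0) 0 ∧
      xField r 0 = !₂[0, r, 0, 0, 0, 0, 0, 0] ∧
      zField r 0 = Phi (xCurve r hr 0) (xField r 0) (yField r 0) ∧
      (∀ T : ℝ, 0 < T → IsParallelAlong (xCurve r hr) 0 T (xField r) ∧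
        IsParallelAlong (xCurve r hr) 0 T (yField r) ∧
        IsParallelAlong (xCurve r hr) 0 T (zField r)) ∧
      -- `span {X₀, Y₀, Z₀}` is special of minimal dimension, and `Φ` is not preserved on it
      (∀ k : SpecialNotion, ∀ u ∈ G2Frames (xCurve r hr 0),
        IsMinimalSpecialSubspace k (frameRep G2 u) (loopSpan r hr)) ∧
      zField r (2 * Real.pi) ≠
        Phi (xCurve r hr (2 * Real.pi)) (xField r (2 * Real.pi)) (yField r (2 * Real.pi))) := by
  refine ⟨fun p X hX Y hY => ⟨Phi_mem_Tan p X Y, fun Z _ => inner_Phi _ _ _ _, ?_, ?_,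
    norm_sq_Phi_of_tangent p hX hY⟩, isReduction_G2Frames,
    fun X Y Z hX hY hZ p => ⟨covPhi_self hX hY hZ p, covCross_self hX hY p⟩,
    not_isWeakHolonomyGroup, fun r hr => ⟨xCurve_two_pi hr, ?_, xField_zero hr, zField_zero hr,
      fun T hT => ⟨?_, ?_, ?_⟩, fun k u hu => isMinimalSpecialSubspace_loopSpan hr k hu,
      zField_two_pi_ne hr⟩⟩
  · rw [inner_Phi, phi_self_second_fourth]
  · rw [inner_Phi, phi_self_right]
  · have h := hasDerivAt_xCurve hr 0
    rw [Real.sin_zero, Real.cos_zero, mul_zero, mul_one, neg_zero] at h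
    rwa [xField_zero hr]
  · exact (isParallelAlong_of_hasDerivAt (hasDerivAt_xField hr) (xField_mem_Tan hr) 1 hT).of_one_mul
  · exact (isParallelAlong_of_hasDerivAt (f := fun _ => 0) (hasDerivAt_yField hr)
      (yField_mem_Tan hr) 1 hT).of_one_mul
  · exact (isParallelAlong_of_hasDerivAt (hasDerivAt_zField hr) (zField_mem_Tan hr) 1 hT).of_one_mul
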